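/- Let $\lambda>0$ and let $\mathcal V\subset\mathbb R^2$ be a stationary Poisson point process with intensity $\lambda$. Each point $u\in\mathcal V$ is assigned a direction $d_u\in\{(0,1),(1,0)\}$, each value with probability $\frac12$, independently of the directions of the other points and of the location of the points. Let $N>2$ be fixed, $\Lambda_N=[0,N]^2$ and $\mathcal V_N=\mathcal V\cap\Lambda_N$. At time $0$, from every point $u\in\mathcal V_N$ two rays begin to grow with speed $1$ in the directions $+d_u$ and $-d_u$; a ray grows until the first time when it reaches another ray and remains unchanged thereafter. Let $G_{\mathcal V_N}(t)\subset\mathbb R^2$ be the union of all these (closed) rays at time $t$, and consider the planar graph drawn by the set $(G_{\mathcal V_N}(N)\cap\Lambda_N)\cup\partial\Lambda_N$; its faces are the connected components of the complement of this set in $\mathbb R^2$. Then almost surely every bounded face is an open (axis-parallel) rectangle, and the number of rectangular faces is exactly $$|\mathcal V_N|+1 .$$ -/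

import Mathlib

open MeasureTheory ProbabilityTheory
open scoped NNReal ENNReal

namespace RectGilbert

/-! ### Growth of the rays from a given set of points with given directions -/

/-- The two possible directions assigned to a point. -/
inductive Direction where
  | horizontal
  | vertical

instance : MeasurableSpace Direction := ⊤

/-- The direction vector: `(1,0)` or `(0,1)`. -/
def Direction.vec : Direction → ℝ × ℝ
  | .horizontal => (1, 0)
  | .vertical => (0, 1)

/-- A ray is labelled by its initial point and by its sign: `(u, 1)` and `(u, -1)` are the rays
growing from `u` in the directions `+ d u` and `- d u`. -/
abbrev Ray : Type := (ℝ × ℝ) × ℤˣ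

/-- The point at distance `t` from the initial point on the half-line of the ray `r`. -/
def tip (d : ℝ × ℝ → Direction) (r : Ray) (t : ℝ) : ℝ × ℝ :=
  r.1 + (((r.2 : ℤ) : ℝ) * t) • (d r.1).vec

/-- The ray `r` at time `t`, if it grows with speed `1` and stops at time `τ r` (`⊤`: never):
the closed segment of length `min t (τ r)`. -/
def rayAt (d : ℝ × ℝ → Direction) (τ : Ray → EReal) (r : Ray) (t : ℝ) : Set (ℝ × ℝ) :=
  tip d r '' {x : ℝ | 0 ≤ x ∧ x ≤ t ∧ (x : EReal) ≤ τ r}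

/-- The times `t > 0` at which the ray `r`, if it still grows, is on another ray
(of the system of rays from the points of `V` with the stopping times `τ`). -/
def hitTimes (V : Set (ℝ × ℝ)) (d : ℝ × ℝ → Direction) (τ : Ray → EReal) (r : Ray) : Set ℝ :=
  {t : ℝ | 0 < t ∧ ∃ r' : Ray, r'.1 ∈ V ∧ r' ≠ r ∧ tip d r t ∈ rayAt d τ r' t}

/-- `τ` is a system of stopping times of the growth from the points of `V`: each ray grows until
the first time when it reaches another ray, and for ever if there is no such time. -/
def IsGrowth (V : Set (ℝ × ℝ)) (d : ℝ × ℝ → Direction) (τ : Ray → EReal) : Prop :=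
  ∀ r : Ray, r.1 ∈ V →
    (hitTimes V d τ r = ∅ ∧ τ r = ⊤) ∨ ∃ t : ℝ, τ r = (t : EReal) ∧ IsLeast (hitTimes V d τ r) t

/-- On rays from `V`, there is at most one system of stopping times. -/
theorem IsGrowth.unique {V : Set (ℝ × ℝ)} (hV : V.Finite) {d : ℝ × ℝ → Direction}
    {τ τ' : Ray → EReal} (h : IsGrowth V d τ) (h' : IsGrowth V d τ') :
    ∀ r : Ray, r.1 ∈ V → τ r = τ' r := by
  have key : ∀ (τ τ' : Ray → EReal), IsGrowth V d τ → IsGrowth V d τ' → ∀ r : Ray, r.1 ∈ V →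
      (∀ r'' : Ray, r''.1 ∈ V → τ r'' ≠ τ' r'' →
        min (τ r) (τ' r) ≤ min (τ r'') (τ' r'')) → ¬ τ r < τ' r := by
    intro τ τ' h h' r hr hmin hlt
    rcases h r hr with ⟨_, h1⟩ | ⟨t, ht, hl⟩
    · rw [h1] at hlt
      exact absurd hlt not_top_lt
    · have hm : t ∈ hitTimes V d τ' r := by
        obtain ⟨h0, r', hr', hne, x, ⟨hx0, hxt, hxτ⟩, hx⟩ := hl.1
        refine ⟨h0, r', hr', hne, x, ⟨hx0, hxt, ?_⟩, hx⟩
        by_cases he : τ r' = τ' r'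
        · rwa [← he]
        · have h2 := hmin r' hr' he
          rw [min_eq_left hlt.le, ht] at h2
          exact (EReal.coe_le_coe_iff.2 hxt).trans (h2.trans (min_le_right _ _))
      rcases h' r hr with ⟨h1, _⟩ | ⟨t', ht', hl'⟩
      · rw [h1] at hm
        exact hm
      · have h3 := hl'.2 hm
        rw [ht, ht'] at hlt
        exact absurd (EReal.coe_lt_coe_iff.1 hlt) (not_lt.2 h3)
  by_contra hcon
  push Not at hcon
  have hfin : {r : Ray | r.1 ∈ V ∧ τ r ≠ τ' r}.Finite :=
    (hV.prod (Set.finite_univ (α := ℤˣ))).subset (fun r hr => ⟨hr.1, Set.mem_univ _⟩)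
  obtain ⟨r, hr, hmin⟩ := Set.exists_min_image _ (fun r => min (τ r) (τ' r)) hfin hcon
  rcases lt_or_gt_of_ne hr.2 with hlt | hlt
  · exact key τ τ' h h' r hr.1 (fun r'' h1 h2 => hmin r'' ⟨h1, h2⟩) hlt
  · refine key τ' τ h' h r hr.1 (fun r'' h1 h2 => ?_) hlt
    rw [min_comm, min_comm (τ' r'')]
    exact hmin r'' ⟨h1, h2.symm⟩

/-- A ray that meets some other ray does so at a first time. -/
theorem exists_isLeast_hitTimes {V : Set (ℝ × ℝ)} (hV : V.Finite) (d : ℝ × ℝ → Direction)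
    (τ : Ray → EReal) (r : Ray) (hne : (hitTimes V d τ r).Nonempty) :
    ∃ t, IsLeast (hitTimes V d τ r) t := by
  have hs : ∀ s : ℤˣ, ((s : ℤ) : ℝ) * ((s : ℤ) : ℝ) = 1 := by
    intro s
    rcases Int.units_eq_one_or s with rfl | rfl <;> norm_num
  -- the parameter on the ray `r'` of a point of its half-line
  let g : Ray → ℝ → ℝ := fun r' t => ((r'.2 : ℤ) : ℝ) *
    ((d r'.1).vec.1 * (tip d r t - r'.1).1 + (d r'.1).vec.2 * (tip d r t - r'.1).2)
  have hg : ∀ r' t x, tip d r' x = tip d r t → x = g r' t := by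
    intro r' t x hx
    have h1 := hs r'.2
    simp only [g]
    rw [← hx]
    simp only [tip]
    cases d r'.1 <;> simp [Direction.vec] <;> linear_combination (-x) * h1
  have hcont : Continuous (tip d r) := by
    unfold tip
    fun_prop
  have hgc : ∀ r', Continuous (g r') := by
    intro r'
    simp only [g]
    fun_prop
  have htc : ∀ r', Continuous (fun t => tip d r' (g r' t)) := by
    intro r'
    have := hgc r'
    unfold tip
    fun_prop
  let K : Ray → Set ℝ := fun r' => {t | 0 ≤ t ∧ 0 ≤ g r' t ∧ g r' t ≤ t ∧
    ((g r' t : ℝ) : EReal) ≤ τ r' ∧ tip d r' (g r' t) = tip d r t}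
  have hK : ∀ r', IsClosed (K r') := by
    intro r'
    refine (isClosed_le continuous_const continuous_id).inter
      ((isClosed_le continuous_const (hgc r')).inter
      ((isClosed_le (hgc r') continuous_id).inter
      ((isClosed_le (continuous_coe_real_ereal.comp (hgc r')) continuous_const).inter
      (isClosed_eq (htc r') hcont))))
  have hEq : hitTimes V d τ r = ⋃ r' ∈ {r' : Ray | r'.1 ∈ V ∧ r'.1 ≠ r.1}, K r' := by
    ext t
    simp only [Set.mem_iUnion, hitTimes, rayAt, Set.mem_ofPred_eq]
    constructor
    · rintro ⟨h0, r', hr', hne', x, ⟨hx0, hxt, hxτ⟩, hx⟩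
      have hxg := hg r' t x hx
      refine ⟨r', ⟨hr', fun he => ?_⟩, h0.le, ?_, ?_, ?_, ?_⟩
      · obtain ⟨u, s⟩ := r
        obtain ⟨u', s'⟩ := r'
        simp only at he
        subst he
        have hss : s' ≠ s := fun h => hne' (by rw [h])
        have : x + t = 0 := by
          rcases Int.units_eq_one_or s with rfl | rfl <;>
            rcases Int.units_eq_one_or s' with rfl | rfl <;>
            first
            | exact absurd rfl hss
            | (cases hd : d u' <;> simp [tip, hd, Direction.vec] at hx <;> linarith)
        linarith
      · rwa [← hxg]
      · rwa [← hxg]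
      · rwa [← hxg]
      · rwa [← hxg]
    · rintro ⟨r', ⟨hr', hne'⟩, h0, h1, h2, h3, h4⟩
      refine ⟨lt_of_le_of_ne h0 ?_, r', hr', fun h => hne' (by rw [h]), g r' t, ⟨h1, h2, h3⟩, h4⟩
      intro ht
      apply hne'
      have hg0 : g r' t = 0 := le_antisymm (h2.trans ht.symm.le) h1
      rw [hg0, ← ht] at h4
      simpa [tip] using h4
  have hfin : {r' : Ray | r'.1 ∈ V ∧ r'.1 ≠ r.1}.Finite :=
    (hV.prod (Set.finite_univ (α := ℤˣ))).subset (fun r hr => ⟨hr.1, Set.mem_univ _⟩)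
  have hcl : IsClosed (hitTimes V d τ r) := by
    rw [hEq]
    exact hfin.isClosed_biUnion (fun r' _ => hK r')
  have hbdd : BddBelow (hitTimes V d τ r) := ⟨0, fun t ht => ht.1.le⟩
  exact ⟨_, hcl.csInf_mem hne hbdd, fun t ht => csInf_le hbdd ht⟩

/-- The growth from finitely many points is well defined. -/
theorem exists_isGrowth {V : Set (ℝ × ℝ)} (hV : V.Finite) (d : ℝ × ℝ → Direction) :
    ∃ τ : Ray → EReal, IsGrowth V d τ := by
  classical
  have hR : {r : Ray | r.1 ∈ V}.Finite :=
    (hV.prod (Set.finite_univ (α := ℤˣ))).subset (fun r hr => ⟨hr, Set.mem_univ _⟩)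
  suffices H : ∀ n : ℕ, ∀ (σ : Ray → EReal) (T : ℝ),
      {r : Ray | r.1 ∈ V ∧ σ r = ⊤}.ncard = n →
      (∀ r : Ray, r.1 ∈ V → (σ r = ⊤ ∧ ∀ t ∈ hitTimes V d σ r, T < t) ∨
        ∃ t : ℝ, t ≤ T ∧ σ r = (t : EReal) ∧ IsLeast (hitTimes V d σ r) t) →
      ∃ τ : Ray → EReal, IsGrowth V d τ from
    H _ (fun _ => ⊤) 0 rfl (fun r _ => Or.inl ⟨rfl, fun t ht => ht.1⟩)
  intro n
  induction n using Nat.strong_induction_on with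
  | _ n ih =>
    intro σ T hn hinv
    by_cases hB : {r : Ray | r.1 ∈ V ∧ σ r = ⊤ ∧ (hitTimes V d σ r).Nonempty}.Nonempty
    · have hBfin : {r : Ray | r.1 ∈ V ∧ σ r = ⊤ ∧ (hitTimes V d σ r).Nonempty}.Finite :=
        hR.subset (fun r hr => hr.1)
      obtain ⟨r₀, hr₀, hmin⟩ :=
        Set.exists_min_image _ (fun r => sInf (hitTimes V d σ r)) hBfin hB
      have hleast : ∀ r, (hitTimes V d σ r).Nonempty →
          IsLeast (hitTimes V d σ r) (sInf (hitTimes V d σ r)) := by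
        intro r hr
        obtain ⟨t, ht⟩ := exists_isLeast_hitTimes hV d σ r hr
        rwa [ht.csInf_eq]
      set T' := sInf (hitTimes V d σ r₀) with hT'
      have hTT' : T < T' := by
        rcases hinv r₀ hr₀.1 with h | ⟨t, _, h, _⟩
        · exact h.2 _ (hleast r₀ hr₀.2.2).1
        · rw [hr₀.2.1] at h
          exact absurd h.symm (EReal.coe_ne_top t)
      let σ' : Ray → EReal := fun r =>
        if (r.1 ∈ V ∧ σ r = ⊤ ∧ (hitTimes V d σ r).Nonempty) ∧ sInf (hitTimes V d σ r) = T'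
        then (T' : EReal) else σ r
      have hagree : ∀ r t, t ≤ T' → (t ∈ hitTimes V d σ' r ↔ t ∈ hitTimes V d σ r) := by
        intro r t ht
        have hx : ∀ (r' : Ray) (x : ℝ), x ≤ t → ((x : EReal) ≤ σ' r' ↔ (x : EReal) ≤ σ r') := by
          intro r' x hxt
          simp only [σ']
          split_ifs with hc
          · rw [hc.1.2.1]
            exact ⟨fun _ => le_top, fun _ => EReal.coe_le_coe_iff.2 (hxt.trans ht)⟩
          · exact Iff.rfl
        constructor
        · rintro ⟨h0, r', hr', hne', x, ⟨hx0, hxt, hxτ⟩, he⟩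
          exact ⟨h0, r', hr', hne', x, ⟨hx0, hxt, (hx r' x hxt).1 hxτ⟩, he⟩
        · rintro ⟨h0, r', hr', hne', x, ⟨hx0, hxt, hxτ⟩, he⟩
          exact ⟨h0, r', hr', hne', x, ⟨hx0, hxt, (hx r' x hxt).2 hxτ⟩, he⟩
      have hleast' : ∀ r t, t ≤ T' → IsLeast (hitTimes V d σ r) t →
          IsLeast (hitTimes V d σ' r) t := by
        intro r t ht hl
        refine ⟨(hagree r t ht).2 hl.1, fun t' ht' => ?_⟩
        by_contra hlt
        push Not at hlt
        exact absurd (hl.2 ((hagree r t' (hlt.le.trans ht)).1 ht')) (not_le.2 hlt)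
      refine ih _ ?_ σ' T' rfl ?_
      · rw [← hn]
        refine Set.ncard_lt_ncard (Set.ssubset_iff_of_subset ?_ |>.2 ?_)
          (hR.subset (fun r hr => hr.1))
        · rintro r ⟨hr, hr'⟩
          refine ⟨hr, ?_⟩
          simp only [σ'] at hr'
          split_ifs at hr' with hc
          · exact hc.1.2.1
          · exact hr'
        · refine ⟨r₀, ⟨hr₀.1, hr₀.2.1⟩, fun h => ?_⟩
          have h2 := h.2
          simp only [σ'] at h2
          rw [if_pos ⟨hr₀, hT'.symm⟩] at h2
          exact EReal.coe_ne_top _ h2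
      · intro r hr
        by_cases hc : (r.1 ∈ V ∧ σ r = ⊤ ∧ (hitTimes V d σ r).Nonempty) ∧
            sInf (hitTimes V d σ r) = T'
        · right
          refine ⟨T', le_rfl, if_pos hc, hleast' r T' le_rfl ?_⟩
          rw [← hc.2]
          exact hleast r hc.1.2.2
        · have hσ : σ' r = σ r := if_neg hc
          rw [hσ]
          rcases hinv r hr with ⟨h1, _⟩ | ⟨t, h1, h2, h3⟩
          · left
            refine ⟨h1, fun t ht => ?_⟩
            by_contra hlt
            push Not at hlt
            have h4 := (hagree r t hlt).1 ht
            have h5 : r.1 ∈ V ∧ σ r = ⊤ ∧ (hitTimes V d σ r).Nonempty := ⟨hr, h1, ⟨t, h4⟩⟩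
            refine hc ⟨h5, le_antisymm ?_ (hmin r h5)⟩
            exact ((hleast r h5.2.2).2 h4).trans hlt
          · right
            exact ⟨t, h1.trans hTT'.le, h2, hleast' r t (h1.trans hTT'.le) h3⟩
    · refine ⟨σ, fun r hr => ?_⟩
      rcases hinv r hr with ⟨h1, _⟩ | ⟨t, _, h2, h3⟩
      · left
        refine ⟨?_, h1⟩
        by_contra hne
        exact hB ⟨r, hr, h1, Set.nonempty_iff_ne_empty.2 hne⟩
      · right
        exact ⟨t, h2, h3⟩

open Classical in
/-- The stopping times of the rays growing from the points of `V`. For a finite set `V` they exist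
and are unique (`exists_isGrowth`, `IsGrowth.unique`); the value `⊤` in the other case is junk. -/
noncomputable def stopTime (V : Set (ℝ × ℝ)) (d : ℝ × ℝ → Direction) : Ray → EReal :=
  if h : ∃ τ : Ray → EReal, IsGrowth V d τ then h.choose else fun _ => ⊤

theorem isGrowth_stopTime {V : Set (ℝ × ℝ)} (hV : V.Finite) (d : ℝ × ℝ → Direction) :
    IsGrowth V d (stopTime V d) := by
  rw [stopTime, dif_pos (exists_isGrowth hV d)]
  exact (exists_isGrowth hV d).choose_spec

/-- The union of all rays from the points of `V` at time `t`. -/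
noncomputable def grown (V : Set (ℝ × ℝ)) (d : ℝ × ℝ → Direction) (t : ℝ) : Set (ℝ × ℝ) :=
  ⋃ r ∈ {r : Ray | r.1 ∈ V}, rayAt d (stopTime V d) r t

/-! ### The planar graph in the square and its faces -/

/-- The closed square `[0,N]²`. -/
def square (N : ℝ) : Set (ℝ × ℝ) := Set.Icc 0 N ×ˢ Set.Icc 0 N

/-- The planar graph (as a subset of the plane) formed by the final configuration, inside the
square, of the rays grown from the points of `V` in the square, and by the boundary of the
square. -/
noncomputable def tessellation (V : Set (ℝ × ℝ)) (d : ℝ × ℝ → Direction) (N : ℝ) : Set (ℝ × ℝ) :=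
  (grown (V ∩ square N) d N ∩ square N) ∪ frontier (square N)

/-- The faces of a planar graph `S`: the connected components of its complement in the plane. -/
def IsFace (S F : Set (ℝ × ℝ)) : Prop :=
  ∃ x ∈ Sᶜ, F = connectedComponentIn Sᶜ x

/-- `F` is a nondegenerate open rectangle with sides parallel to the coordinate axes. -/
def IsRectangle (F : Set (ℝ × ℝ)) : Prop :=
  ∃ a b c e : ℝ, a < b ∧ c < e ∧ F = Set.Ioo a b ×ˢ Set.Ioo c e

/-! ### The random initial state -/

/-- `𝒱` is a stationary Poisson point process in the plane with intensity `l`. -/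
structure IsPoissonProcess {Ω : Type*} [MeasurableSpace Ω] (P : Measure Ω) (l : ℝ≥0)
    (𝒱 : Ω → Set (ℝ × ℝ)) : Prop where
  locallyFinite : ∀ᵐ ω ∂P, ∀ B : Set (ℝ × ℝ), Bornology.IsBounded B → (𝒱 ω ∩ B).Finite
  measurable_count : ∀ B : Set (ℝ × ℝ), MeasurableSet B → Bornology.IsBounded B →
    Measurable (fun ω => (𝒱 ω ∩ B).ncard)
  law_count : ∀ B : Set (ℝ × ℝ), MeasurableSet B → Bornology.IsBounded B →
    P.map (fun ω => (𝒱 ω ∩ B).ncard) = poissonMeasure (l * (volume B).toNNReal)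
  indep_count : ∀ (k : ℕ) (B : Fin k → Set (ℝ × ℝ)), (∀ i, MeasurableSet (B i)) →
    (∀ i, Bornology.IsBounded (B i)) → Pairwise (fun i j => Disjoint (B i) (B j)) →
    iIndepFun (fun i ω => (𝒱 ω ∩ B i).ncard) P

/-- The directions `d ω u` of the points `u` of the (almost surely infinite) random set `𝒱 ω` are
independent of each other and of the location of the points, and each of them is horizontal or
vertical with probability `1/2`: for some measurable enumeration `ξ` of the points without
repetitions, the directions of `ξ 0, ξ 1, …` are independent fair marks, independent of `ξ`. -/
def IsIndependentMarking {Ω : Type*} [MeasurableSpace Ω] (P : Measure Ω)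
    (𝒱 : Ω → Set (ℝ × ℝ)) (d : Ω → ℝ × ℝ → Direction) : Prop :=
  ∃ ξ : ℕ → Ω → ℝ × ℝ,
    (∀ i, Measurable (ξ i)) ∧
    (∀ᵐ ω ∂P, Function.Injective (fun i => ξ i ω) ∧ Set.range (fun i => ξ i ω) = 𝒱 ω) ∧
    (∀ i, Measurable (fun ω => d ω (ξ i ω))) ∧
    (∀ i, P {ω | d ω (ξ i ω) = Direction.vertical} = 1 / 2 ∧
      P {ω | d ω (ξ i ω) = Direction.horizontal} = 1 / 2) ∧
    iIndepFun (fun i ω => d ω (ξ i ω)) P ∧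
    IndepFun (fun ω i => ξ i ω) (fun ω (i : ℕ) => d ω (ξ i ω)) P

end RectGilbert

namespace RectGilbert

/-! ### Arrangements of segments in a square -/

/-! Almost surely the points of the square are in general position
(`IsPoissonProcess.ae_isGeneric`): they are interior, and no two of them lie on a horizontal,
vertical or diagonal line. The rest is deterministic and holds for any directions.

In general position a ray can only meet a perpendicular ray, and two perpendicular rays never reach
their common point at the same time, because their starting points would lie on a diagonal. Hence
the later one is blocked inside the earlier one, and the grown segments together with the sides of
the square form an `IsArrangement`: no crossings, and every end inside the square lies in the
interior of a perpendicular segment (`IsReach.isArrangement`).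

In an arrangement, a maximal open rectangle around a point off the graph has each side covered by a
single segment, since a segment ending along a side would force another one into the rectangle. So
the bounded faces are exactly these cells (`exists_isCell`, `exists_isCell_of_isBounded`).

A cell is determined by its lower left corner (`ncard_rectangles`). As nothing crosses, each such
corner is the left end of a horizontal segment or the lower end of a vertical one. Every grown
segment contributes one corner, all of them different, and the four sides contribute only `(0, 0)`.
The total is the number of points plus one (`IsReach.ncard_corners`). -/

/-- The closed box `[left, right] × [bot, top]`, given by its four sides. -/
structure Box where
  left : ℝ
  right : ℝ
  bot : ℝ
  top : ℝ

/-- The points of a box. -/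
def Box.toSet (B : Box) : Set (ℝ × ℝ) := Set.Icc B.left B.right ×ˢ Set.Icc B.bot B.top

/-- A horizontal segment. -/
def Box.IsHor (B : Box) : Prop := B.left < B.right ∧ B.bot = B.top

/-- A vertical segment. -/
def Box.IsVer (B : Box) : Prop := B.left = B.right ∧ B.bot < B.top

/-- A family of horizontal and vertical segments in the square `[0,N]²` that contains the four
sides of the square, and in which the segments do not cross and end inside perpendicular ones. -/
structure IsArrangement {ι : Type*} (N : ℝ) (B : ι → Box) : Prop where
  isHor_or_isVer : ∀ i, (B i).IsHor ∨ (B i).IsVer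
  left_nonneg : ∀ i, 0 ≤ (B i).left
  right_le : ∀ i, (B i).right ≤ N
  bot_nonneg : ∀ i, 0 ≤ (B i).bot
  top_le : ∀ i, (B i).top ≤ N
  end_left : ∀ i, (B i).IsHor → 0 < (B i).left →
    ∃ j, (B j).IsVer ∧ (B j).left = (B i).left ∧ (B j).bot < (B i).bot ∧ (B i).bot < (B j).top
  end_right : ∀ i, (B i).IsHor → (B i).right < N →
    ∃ j, (B j).IsVer ∧ (B j).left = (B i).right ∧ (B j).bot < (B i).bot ∧ (B i).bot < (B j).top
  end_bot : ∀ i, (B i).IsVer → 0 < (B i).bot →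
    ∃ j, (B j).IsHor ∧ (B j).bot = (B i).bot ∧ (B j).left < (B i).left ∧ (B i).left < (B j).right
  end_top : ∀ i, (B i).IsVer → (B i).top < N →
    ∃ j, (B j).IsHor ∧ (B j).bot = (B i).top ∧ (B j).left < (B i).left ∧ (B i).left < (B j).right
  not_cross : ∀ i j, (B i).IsHor → (B j).IsVer →
    ¬ ((B i).left < (B j).left ∧ (B j).left < (B i).right ∧
      (B j).bot < (B i).bot ∧ (B i).bot < (B j).top)
  side_left : ∃ i, B i = ⟨0, 0, 0, N⟩
  side_right : ∃ i, B i = ⟨N, N, 0, N⟩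
  side_bot : ∃ i, B i = ⟨0, N, 0, 0⟩
  side_top : ∃ i, B i = ⟨0, N, N, N⟩

/-- A point outside of finitely many closed intervals, some of them on either side of it, lies in
a largest open interval disjoint from all of them. -/
theorem exists_maximal_gap {ι : Type*} [Finite ι] (J : Set ι) (l r : ι → ℝ) {x : ℝ}
    (miss : ∀ i ∈ J, r i < x ∨ x < l i) (hl : ∃ i ∈ J, r i < x) (hr : ∃ i ∈ J, x < l i) :
    ∃ a b, a < x ∧ x < b ∧ (∀ i ∈ J, r i ≤ a ∨ b ≤ l i) ∧ (∃ i ∈ J, r i = a) ∧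
      ∃ i ∈ J, l i = b := by
  obtain ⟨i, hi, hmax⟩ := Set.exists_max_image {i | i ∈ J ∧ r i < x} r (Set.toFinite _) hl
  obtain ⟨j, hj, hmin⟩ := Set.exists_min_image {i | i ∈ J ∧ x < l i} l (Set.toFinite _) hr
  exact ⟨r i, l j, hi.2, hj.2, fun k hk => (miss k hk).imp (fun h => hmax k ⟨hk, h⟩)
    (fun h => hmin k ⟨hk, h⟩), ⟨i, hi.1, rfl⟩, ⟨j, hj.1, rfl⟩⟩

/-- If the left side of an open rectangle that misses all segments meets a segment, then it is
contained in a segment. -/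
theorem exists_side {ι : Type*} {l r b t : ι → ℝ} {a a' c e : ℝ} (ha : a < a')
    (hv : ∀ i, (l i < r i ∧ b i = t i) ∨ (l i = r i ∧ b i < t i))
    (miss : ∀ i, ¬ (l i < a' ∧ a < r i ∧ b i < e ∧ c < t i))
    (touch : ∃ i, r i = a ∧ b i < e ∧ c < t i)
    (hright : ∀ i, l i < r i → b i = t i → r i = a →
      ∃ j, (l j = r j ∧ b j < t j) ∧ l j = r i ∧ b j < b i ∧ b i < t j)
    (hbot : ∀ i, l i = r i → b i < t i → c < b i →
      ∃ j, (l j < r j ∧ b j = t j) ∧ b j = b i ∧ l j < l i ∧ l i < r j)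
    (htop : ∀ i, l i = r i → b i < t i → t i < e →
      ∃ j, (l j < r j ∧ b j = t j) ∧ b j = t i ∧ l j < l i ∧ l i < r j) :
    ∃ j, l j = a ∧ r j = a ∧ b j ≤ c ∧ e ≤ t j := by
  -- The touching segment may be taken vertical: a horizontal one ending on the line ends inside a
  -- vertical one, which touches at the same point.
  obtain ⟨j, hj, hlj, hj1, hj2⟩ :
      ∃ j, (l j = r j ∧ b j < t j) ∧ l j = a ∧ b j < e ∧ c < t j := by
    obtain ⟨i, hi, h1, h2⟩ := touch
    rcases hv i with h | h
    · obtain ⟨j, hj, h3, h4, h5⟩ := hright i h.1 h.2 hi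
      exact ⟨j, hj, h3.trans hi, by linarith, by linarith [h.2]⟩
    · exact ⟨i, h, h.1.trans hi, h1, h2⟩
  refine ⟨j, hlj, hj.1 ▸ hlj, ?_, ?_⟩
  -- A vertical segment ending strictly between the two corners would end inside a horizontal
  -- segment, and that one would enter the rectangle.
  · by_contra! hlt
    obtain ⟨k, hk, h1, h2, h3⟩ := hbot j hj.1 hj.2 hlt
    exact miss k ⟨by linarith, by linarith, by linarith, by linarith [hk.2]⟩
  · by_contra! hlt
    obtain ⟨k, hk, h1, h2, h3⟩ := htop j hj.1 hj.2 hlt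
    exact miss k ⟨by linarith, by linarith, by linarith, by linarith [hk.2]⟩

/-- The open rectangle `(a,a') × (c,c')` misses all segments of the family `B`, and its sides are
contained in segments. -/
structure IsCell {ι : Type*} (B : ι → Box) (a a' c c' : ℝ) : Prop where
  lt_x : a < a'
  lt_y : c < c'
  miss : ∀ i, ¬ ((B i).left < a' ∧ a < (B i).right ∧ (B i).bot < c' ∧ c < (B i).top)
  side_left : ∃ j, (B j).left = a ∧ (B j).right = a ∧ (B j).bot ≤ c ∧ c' ≤ (B j).top
  side_right : ∃ j, (B j).left = a' ∧ (B j).right = a' ∧ (B j).bot ≤ c ∧ c' ≤ (B j).top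
  side_bot : ∃ j, (B j).bot = c ∧ (B j).top = c ∧ (B j).left ≤ a ∧ a' ≤ (B j).right
  side_top : ∃ j, (B j).bot = c' ∧ (B j).top = c' ∧ (B j).left ≤ a ∧ a' ≤ (B j).right

namespace IsArrangement

variable {ι : Type*} {N : ℝ} {B : ι → Box}

/-- The rectangle is grown in two stages: as wide as possible along the horizontal line through `p`,
then as high as possible with that width. Maximality leaves a segment touching each of the four
sides, which is the input of `exists_side`. -/
theorem exists_isCell [Finite ι] (h : IsArrangement N B) {p : ℝ × ℝ}
    (hp1 : p.1 ∈ Set.Ioo 0 N) (hp2 : p.2 ∈ Set.Ioo 0 N) (hp : ∀ i, p ∉ (B i).toSet) :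
    ∃ a a' c c', IsCell B a a' c c' ∧ p.1 ∈ Set.Ioo a a' ∧ p.2 ∈ Set.Ioo c c' := by
  obtain ⟨il, hil⟩ := h.side_left
  obtain ⟨ir, hir⟩ := h.side_right
  obtain ⟨ib, hib⟩ := h.side_bot
  obtain ⟨it, hit⟩ := h.side_top
  have hN : 0 < N := hp1.1.trans hp1.2
  obtain ⟨a, a', ha, ha', hmx, ⟨i, ⟨hi1, hi2⟩, hia⟩, ⟨i', ⟨hi1', hi2'⟩, hia'⟩⟩ :=
    exists_maximal_gap {i | (B i).bot ≤ p.2 ∧ p.2 ≤ (B i).top}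
      (fun i => (B i).left) (fun i => (B i).right) (x := p.1)
      (by
        intro i hi
        by_contra! hcon
        exact hp i ⟨⟨hcon.2, hcon.1⟩, hi⟩)
      ⟨il, by simp [hil, hp2.1.le, hp2.2.le], by simpa [hil] using hp1.1⟩
      ⟨ir, by simp [hir, hp2.1.le, hp2.2.le], by simpa [hir] using hp1.2⟩
  have ha0 : 0 ≤ a := by
    rcases h.isHor_or_isVer i with h1 | h1 <;> have := h1.1 <;> have := h.left_nonneg i <;>
      linarith
  have haN : a' ≤ N := by
    rcases h.isHor_or_isVer i' with h1 | h1 <;> have := h1.1 <;> have := h.right_le i' <;>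
      linarith
  -- Only segments whose projection meets the open interval `(a, a')` can obstruct; by the choice of
  -- `a` and `a'` none of them has height `p.2`.
  obtain ⟨c, c', hc, hc', hmy, ⟨k, ⟨hk1, hk2⟩, hkc⟩, ⟨k', ⟨hk1', hk2'⟩, hkc'⟩⟩ :=
    exists_maximal_gap {i | (B i).left < a' ∧ a < (B i).right}
      (fun i => (B i).bot) (fun i => (B i).top) (x := p.2)
      (by
        intro i hi
        by_contra! hcon
        rcases hmx i ⟨hcon.2, hcon.1⟩ with h1 | h1
        · exact absurd hi.2 (not_lt.2 h1)
        · exact absurd hi.1 (not_lt.2 h1))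
      ⟨ib, by simp only [hib, Set.mem_ofPred_eq]; exact ⟨by linarith, by linarith [hp1.2]⟩,
        by simpa [hib] using hp2.1⟩
      ⟨it, by simp only [hit, Set.mem_ofPred_eq]; exact ⟨by linarith, by linarith [hp1.2]⟩,
        by simpa [hit] using hp2.2⟩
  have hc0 : 0 ≤ c := by
    rcases h.isHor_or_isVer k with h1 | h1 <;> have := h1.2 <;> have := h.bot_nonneg k <;> linarith
  have hcN : c' ≤ N := by
    rcases h.isHor_or_isVer k' with h1 | h1 <;> have := h1.2 <;> have := h.top_le k' <;> linarith
  have hx : a < a' := ha.trans ha'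
  have hy : c < c' := hc.trans hc'
  have miss : ∀ i, ¬ ((B i).left < a' ∧ a < (B i).right ∧ (B i).bot < c' ∧ c < (B i).top) := by
    rintro i ⟨h1, h2, h3, h4⟩
    rcases hmy i ⟨h1, h2⟩ with h5 | h5 <;> linarith
  have hv := h.isHor_or_isVer
  refine ⟨a, a', c, c', ⟨hx, hy, miss, ?_, ?_, ?_, ?_⟩, ⟨ha, ha'⟩, ⟨hc, hc'⟩⟩
  · exact exists_side hx hv miss ⟨i, hia, by linarith, by linarith⟩
      (fun i h1 h2 h3 => h.end_right i ⟨h1, h2⟩ (by linarith))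
      (fun i h1 h2 h3 => h.end_bot i ⟨h1, h2⟩ (by linarith))
      (fun i h1 h2 h3 => h.end_top i ⟨h1, h2⟩ (by linarith))
  -- The other three sides reduce to the left one by reflecting and exchanging the coordinates.
  · obtain ⟨j, h1, h2, h3, h4⟩ := exists_side (l := fun i => -(B i).right)
      (r := fun i => -(B i).left) (b := fun i => (B i).bot) (t := fun i => (B i).top)
      (a := -a') (a' := -a) (c := c) (e := c') (by linarith)
      (fun i => (hv i).imp (fun h => ⟨by linarith [h.1], h.2⟩) (fun h => ⟨by linarith [h.1], h.2⟩))
      (fun i hi => miss i ⟨by linarith, by linarith, hi.2.2⟩)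
      ⟨i', by linarith, by linarith, by linarith⟩
      (fun i h1 h2 h3 => by
        obtain ⟨j, hj, h4⟩ := h.end_left i ⟨by linarith, h2⟩ (by linarith)
        exact ⟨j, ⟨by linarith [hj.1], hj.2⟩, by linarith [hj.1], h4.2⟩)
      (fun i h1 h2 h3 => by
        obtain ⟨j, hj, h4⟩ := h.end_bot i ⟨by linarith, h2⟩ (by linarith)
        exact ⟨j, ⟨by linarith [hj.1], hj.2⟩, h4.1, by linarith, by linarith⟩)
      (fun i h1 h2 h3 => by
        obtain ⟨j, hj, h4⟩ := h.end_top i ⟨by linarith, h2⟩ (by linarith)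
        exact ⟨j, ⟨by linarith [hj.1], hj.2⟩, h4.1, by linarith, by linarith⟩)
    exact ⟨j, by linarith, by linarith, h3, h4⟩
  · obtain ⟨j, h1, h2, h3, h4⟩ := exists_side (l := fun i => (B i).bot)
      (r := fun i => (B i).top) (b := fun i => (B i).left) (t := fun i => (B i).right)
      (a := c) (a' := c') (c := a) (e := a') hy
      (fun i => (hv i).symm.imp (fun h => ⟨h.2, h.1⟩) (fun h => ⟨h.2, h.1⟩))
      (fun i hi => miss i ⟨hi.2.2.1, hi.2.2.2, hi.1, hi.2.1⟩)
      ⟨k, hkc, hk1, hk2⟩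
      (fun i h1 h2 h3 => by
        obtain ⟨j, hj, h4⟩ := h.end_top i ⟨h2, h1⟩ (by linarith)
        exact ⟨j, ⟨hj.2, hj.1⟩, h4⟩)
      (fun i h1 h2 h3 => by
        obtain ⟨j, hj, h4⟩ := h.end_left i ⟨h2, h1⟩ (by linarith)
        exact ⟨j, ⟨hj.2, hj.1⟩, h4⟩)
      (fun i h1 h2 h3 => by
        obtain ⟨j, hj, h4⟩ := h.end_right i ⟨h2, h1⟩ (by linarith)
        exact ⟨j, ⟨hj.2, hj.1⟩, h4⟩)
    exact ⟨j, h1, h2, h3, h4⟩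
  · obtain ⟨j, h1, h2, h3, h4⟩ := exists_side (l := fun i => -(B i).top)
      (r := fun i => -(B i).bot) (b := fun i => (B i).left) (t := fun i => (B i).right)
      (a := -c') (a' := -c) (c := a) (e := a') (by linarith)
      (fun i => (hv i).symm.imp (fun h => ⟨by linarith [h.2], h.1⟩)
        (fun h => ⟨by linarith [h.2], h.1⟩))
      (fun i hi => miss i ⟨hi.2.2.1, hi.2.2.2, by linarith, by linarith⟩)
      ⟨k', by linarith, hk1', hk2'⟩
      (fun i h1 h2 h3 => by
        obtain ⟨j, hj, h4⟩ := h.end_bot i ⟨h2, by linarith⟩ (by linarith)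
        exact ⟨j, ⟨by linarith [hj.2], hj.1⟩, by linarith [hj.2], h4.2⟩)
      (fun i h1 h2 h3 => by
        obtain ⟨j, hj, h4⟩ := h.end_left i ⟨h2, by linarith⟩ (by linarith)
        exact ⟨j, ⟨by linarith [hj.2], hj.1⟩, h4.1, by linarith, by linarith⟩)
      (fun i h1 h2 h3 => by
        obtain ⟨j, hj, h4⟩ := h.end_right i ⟨h2, by linarith⟩ (by linarith)
        exact ⟨j, ⟨by linarith [hj.2], hj.1⟩, h4.1, by linarith, by linarith⟩)
    exact ⟨j, by linarith, by linarith, h3, h4⟩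

end IsArrangement

/-! ### The faces of an arrangement -/

namespace IsCell

variable {ι : Type*} {B : ι → Box} {a a' c c' : ℝ}

theorem subset_compl (h : IsCell B a a' c c') :
    Set.Ioo a a' ×ˢ Set.Ioo c c' ⊆ (⋃ i, (B i).toSet)ᶜ := by
  rintro p ⟨⟨h1, h2⟩, h3, h4⟩ hp
  obtain ⟨i, ⟨h5, h6⟩, h7, h8⟩ := Set.mem_iUnion.1 hp
  exact h.miss i ⟨by linarith, by linarith, by linarith, by linarith⟩

theorem frontier_subset (h : IsCell B a a' c c') :
    frontier (Set.Ioo a a' ×ˢ Set.Ioo c c') ⊆ ⋃ i, (B i).toSet := by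
  rw [frontier_prod_eq, closure_Ioo h.lt_x.ne, closure_Ioo h.lt_y.ne, frontier_Ioo h.lt_x,
    frontier_Ioo h.lt_y]
  rintro p (⟨⟨h1, h2⟩, h3 | h3⟩ | ⟨h3 | h3, h1, h2⟩)
  · obtain ⟨j, h4, h5, h6, h7⟩ := h.side_bot
    exact Set.mem_iUnion.2 ⟨j, ⟨by linarith, by linarith⟩, by linarith, by linarith⟩
  · obtain ⟨j, h4, h5, h6, h7⟩ := h.side_top
    have h3 : p.2 = c' := h3
    exact Set.mem_iUnion.2 ⟨j, ⟨by linarith, by linarith⟩, by linarith, by linarith⟩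
  · obtain ⟨j, h4, h5, h6, h7⟩ := h.side_left
    exact Set.mem_iUnion.2 ⟨j, ⟨by linarith, by linarith⟩, by linarith, by linarith⟩
  · obtain ⟨j, h4, h5, h6, h7⟩ := h.side_right
    have h3 : p.1 = a' := h3
    exact Set.mem_iUnion.2 ⟨j, ⟨by linarith, by linarith⟩, by linarith, by linarith⟩

/-- A connected set that avoids the graph cannot leave the rectangle, whose frontier lies in the
graph; the rectangle itself is convex. -/
theorem connectedComponentIn_eq (h : IsCell B a a' c c') {p : ℝ × ℝ}
    (hp : p ∈ Set.Ioo a a' ×ˢ Set.Ioo c c') :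
    connectedComponentIn (⋃ i, (B i).toSet)ᶜ p = Set.Ioo a a' ×ˢ Set.Ioo c c' := by
  refine Set.Subset.antisymm ?_ ?_
  · refine isPreconnected_connectedComponentIn.subset_of_closure_inter_subset
      (isOpen_Ioo.prod isOpen_Ioo) ⟨p, mem_connectedComponentIn (h.subset_compl hp), hp⟩ ?_
    rintro q ⟨hq1, hq2⟩
    by_contra hcon
    refine connectedComponentIn_subset _ _ hq2 (h.frontier_subset ?_)
    rw [(isOpen_Ioo.prod isOpen_Ioo).frontier_eq]
    exact ⟨hq1, hcon⟩
  · exact ((convex_Ioo a a').prod (convex_Ioo c c')).isPreconnected.subset_connectedComponentIn hp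
      h.subset_compl

theorem isFace (h : IsCell B a a' c c') :
    IsFace (⋃ i, (B i).toSet) (Set.Ioo a a' ×ˢ Set.Ioo c c') := by
  have hp : ((a + a') / 2, (c + c') / 2) ∈ Set.Ioo a a' ×ˢ Set.Ioo c c' := by
    have := h.lt_x
    have := h.lt_y
    constructor <;> constructor <;> dsimp only <;> linarith
  exact ⟨_, h.subset_compl hp, (h.connectedComponentIn_eq hp).symm⟩

theorem isRectangle (h : IsCell B a a' c c') : IsRectangle (Set.Ioo a a' ×ˢ Set.Ioo c c') :=
  ⟨a, a', c, c', h.lt_x, h.lt_y, rfl⟩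

end IsCell

theorem IsFace.eq_of_mem {S F F' : Set (ℝ × ℝ)} (h : IsFace S F) (h' : IsFace S F') {p : ℝ × ℝ}
    (hp : p ∈ F) (hp' : p ∈ F') : F = F' := by
  obtain ⟨x, hx, rfl⟩ := h
  obtain ⟨y, hy, rfl⟩ := h'
  rw [connectedComponentIn_eq hp, connectedComponentIn_eq hp']

theorem IsRectangle.isBounded {F : Set (ℝ × ℝ)} (h : IsRectangle F) : Bornology.IsBounded F := by
  obtain ⟨a, b, c, e, _, _, rfl⟩ := h
  exact (Metric.isBounded_Ioo a b).prod (Metric.isBounded_Ioo c e)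

/-- A face that contains the initial point of a half-line disjoint from the graph is unbounded. -/
theorem not_isBounded_of_halfLine {S : Set (ℝ × ℝ)} {x v : ℝ × ℝ} (hv : v ≠ 0)
    (h : ∀ s : ℝ, 0 ≤ s → x + s • v ∉ S) :
    ¬ Bornology.IsBounded (connectedComponentIn Sᶜ x) := by
  intro hb
  have hsub : (fun s : ℝ => x + s • v) '' Set.Ici 0 ⊆ connectedComponentIn Sᶜ x := by
    refine IsPreconnected.subset_connectedComponentIn ?_ ⟨0, Set.self_mem_Ici, by simp⟩ ?_
    · exact isPreconnected_Ici.image _ (by fun_prop)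
    · rintro _ ⟨s, hs, rfl⟩
      exact h s hs
  obtain ⟨C, hC⟩ := (hb.subset hsub).exists_norm_le
  have hv' : 0 < ‖v‖ := norm_pos_iff.2 hv
  have hCx : 0 ≤ C := (norm_nonneg _).trans (hC x ⟨0, Set.self_mem_Ici, by simp⟩)
  have hs : 0 ≤ (C + ‖x‖ + 1) / ‖v‖ := by positivity
  have h1 := hC _ ⟨_, hs, rfl⟩
  have h2 : ‖((C + ‖x‖ + 1) / ‖v‖) • v‖ = C + ‖x‖ + 1 := by
    rw [norm_smul, Real.norm_of_nonneg hs]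
    field_simp
  have h3 := norm_sub_norm_le (((C + ‖x‖ + 1) / ‖v‖) • v) (-x)
  rw [norm_neg, sub_neg_eq_add, add_comm _ x] at h3
  dsimp only at h1
  linarith

/-- The points from which segments of the family start to the right and upwards: the lower left
corners of the cells. -/
def corners {ι : Type*} (B : ι → Box) : Set (ℝ × ℝ) :=
  {k | ∃ i j, (B i).IsVer ∧ (B j).IsHor ∧
    (B i).left = k.1 ∧ (B i).bot ≤ k.2 ∧ k.2 < (B i).top ∧
    (B j).bot = k.2 ∧ (B j).left ≤ k.1 ∧ k.1 < (B j).right}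

theorem IsCell.mem_corners {ι : Type*} {B : ι → Box} {a a' c c' : ℝ}
    (hc : IsCell B a a' c c') : (a, c) ∈ corners B := by
  obtain ⟨i, h1, h2, h3, h4⟩ := hc.side_left
  obtain ⟨j, h5, h6, h7, h8⟩ := hc.side_bot
  have hx := hc.lt_x
  have hy := hc.lt_y
  refine ⟨i, j, ⟨h1.trans h2.symm, by linarith⟩, ⟨by linarith, h5.trans h6.symm⟩, h1, h3,
    by dsimp only; linarith, h5, h7, by dsimp only; linarith⟩

/-- Used to move off a corner by less than the distance to the next coordinate of any segment end.
-/
theorem exists_between_finite {A : Set ℝ} (hA : A.Finite) (k : ℝ) (hne : ∃ y ∈ A, k < y) :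
    ∃ x, k < x ∧ ∀ y ∈ A, k < y → x < y := by
  obtain ⟨y, hy, hmin⟩ := Set.exists_min_image {y | y ∈ A ∧ k < y} id
    (hA.subset fun _ h => h.1) hne
  obtain ⟨x, h1, h2⟩ := exists_between hy.2
  exact ⟨x, h1, fun z hz hkz => h2.trans_le (hmin z ⟨hz, hkz⟩)⟩

/-! ### Bounded faces are cells, and cells correspond to lower left corners. -/

namespace IsArrangement

variable {ι : Type*} {N : ℝ} {B : ι → Box}

theorem toSet_subset (h : IsArrangement N B) : ⋃ i, (B i).toSet ⊆ square N := by
  intro p hp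
  obtain ⟨i, ⟨h1, h2⟩, h3, h4⟩ := Set.mem_iUnion.1 hp
  exact ⟨⟨(h.left_nonneg i).trans h1, h2.trans (h.right_le i)⟩,
    ⟨(h.bot_nonneg i).trans h3, h4.trans (h.top_le i)⟩⟩

/-- From a point outside the square a half-line escapes without meeting the graph, so a bounded face
consists of points of the open square. -/
theorem exists_isCell_of_isBounded [Finite ι] (h : IsArrangement N B) {F : Set (ℝ × ℝ)}
    (hF : IsFace (⋃ i, (B i).toSet) F) (hb : Bornology.IsBounded F) :
    ∃ a a' c c', IsCell B a a' c c' ∧ F = Set.Ioo a a' ×ˢ Set.Ioo c c' := by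
  obtain ⟨x, hx, rfl⟩ := hF
  have hS := h.toSet_subset
  have hx1 : 0 ≤ x.1 := by
    by_contra! hlt
    refine not_isBounded_of_halfLine (v := (-1, 0)) (by simp) (fun s hs hmem => ?_) hb
    have := (hS hmem).1.1
    simp at this
    linarith
  have hx2 : x.1 ≤ N := by
    by_contra! hlt
    refine not_isBounded_of_halfLine (v := (1, 0)) (by simp) (fun s hs hmem => ?_) hb
    have := (hS hmem).1.2
    simp at this
    linarith
  have hx3 : 0 ≤ x.2 := by
    by_contra! hlt
    refine not_isBounded_of_halfLine (v := (0, -1)) (by simp) (fun s hs hmem => ?_) hb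
    have := (hS hmem).2.1
    simp at this
    linarith
  have hx4 : x.2 ≤ N := by
    by_contra! hlt
    refine not_isBounded_of_halfLine (v := (0, 1)) (by simp) (fun s hs hmem => ?_) hb
    have := (hS hmem).2.2
    simp at this
    linarith
  have hxi : ∀ i, x ∉ (B i).toSet := fun i hi => hx (Set.mem_iUnion.2 ⟨i, hi⟩)
  obtain ⟨a, a', c, c', hc, h1, h2⟩ := h.exists_isCell (p := x)
    ⟨lt_of_le_of_ne hx1 fun h0 => by
      obtain ⟨i, hi⟩ := h.side_left
      exact hxi i (by rw [hi]; exact ⟨⟨hx1, h0.ge⟩, hx3, hx4⟩),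
    lt_of_le_of_ne hx2 fun h0 => by
      obtain ⟨i, hi⟩ := h.side_right
      exact hxi i (by rw [hi]; exact ⟨⟨h0.ge, hx2⟩, hx3, hx4⟩)⟩
    ⟨lt_of_le_of_ne hx3 fun h0 => by
      obtain ⟨i, hi⟩ := h.side_bot
      exact hxi i (by rw [hi]; exact ⟨⟨hx1, hx2⟩, hx3, h0.ge⟩),
    lt_of_le_of_ne hx4 fun h0 => by
      obtain ⟨i, hi⟩ := h.side_top
      exact hxi i (by rw [hi]; exact ⟨⟨hx1, hx2⟩, h0.ge, hx4⟩)⟩ hxi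
  exact ⟨a, a', c, c', hc, hc.connectedComponentIn_eq ⟨h1, h2⟩⟩

/-- The cell is the one around a point `(x, y)` just to the right of and above `k`, with no end
coordinate of a segment in `(k.1, x]` or `(k.2, y]`. -/
theorem exists_isCell_of_mem_corners [Finite ι] (h : IsArrangement N B) {k : ℝ × ℝ}
    (hk : k ∈ corners B) : ∃ a' c', IsCell B k.1 a' k.2 c' := by
  obtain ⟨i, j, hi, hj, h1, h2, h3, h4, h5, h6⟩ := hk
  obtain ⟨ir, hir⟩ := h.side_right
  obtain ⟨it, hit⟩ := h.side_top
  have hkN := h6.trans_le (h.right_le j)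
  have hkN' := h3.trans_le (h.top_le i)
  have hk0 := h.left_nonneg i
  have hk0' := h.bot_nonneg j
  obtain ⟨x, hx, hxA⟩ := exists_between_finite
    ((Set.finite_range fun i => (B i).left).union (Set.finite_range fun i => (B i).right)) k.1
    ⟨(B j).right, Or.inr ⟨j, rfl⟩, h6⟩
  obtain ⟨y, hy, hyA⟩ := exists_between_finite
    ((Set.finite_range fun i => (B i).bot).union (Set.finite_range fun i => (B i).top)) k.2
    ⟨(B i).top, Or.inr ⟨i, rfl⟩, h3⟩
  have hxl : ∀ i, k.1 < (B i).left → x < (B i).left := fun i => hxA _ (Or.inl ⟨i, rfl⟩)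
  have hxr : ∀ i, k.1 < (B i).right → x < (B i).right := fun i => hxA _ (Or.inr ⟨i, rfl⟩)
  have hyb : ∀ i, k.2 < (B i).bot → y < (B i).bot := fun i => hyA _ (Or.inl ⟨i, rfl⟩)
  have hyt : ∀ i, k.2 < (B i).top → y < (B i).top := fun i => hyA _ (Or.inr ⟨i, rfl⟩)
  have hxN : x < N := by simpa [hir] using hxl ir (by rw [hir]; exact hkN)
  have hyN : y < N := by simpa [hit] using hyb it (by rw [hit]; exact hkN')
  have hp : ∀ i, ((x, y) : ℝ × ℝ) ∉ (B i).toSet := by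
    rintro m ⟨⟨e1, e2⟩, e3, e4⟩
    dsimp only at e1 e2 e3 e4
    rcases h.isHor_or_isVer m with hm | hm
    · have := hyb m (by linarith [hm.2])
      linarith
    · have := hxl m (by linarith [hm.1])
      linarith
  obtain ⟨a, a', c, c', hc, ⟨g1, g2⟩, g3, g4⟩ := h.exists_isCell (p := (x, y))
    ⟨by dsimp only; linarith, hxN⟩ ⟨by dsimp only; linarith, hyN⟩ hp
  dsimp only at g1 g2 g3 g4
  -- A cell reaching further left would contain points of the vertical segment `i`; a cell starting
  -- further right would have a side with abscissa between `k.1` and `x`.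
  have ha : a = k.1 := by
    have e1 : k.1 ≤ a := by
      by_contra! hlt
      have := hyt i h3
      exact hc.miss i ⟨by linarith, by linarith [hi.1], by linarith, by linarith⟩
    refine le_antisymm ?_ e1
    by_contra! hlt
    obtain ⟨m, hm, -⟩ := hc.side_left
    have := hxl m (by linarith)
    linarith
  have hc' : c = k.2 := by
    have e1 : k.2 ≤ c := by
      by_contra! hlt
      have := hxr j h6
      exact hc.miss j ⟨by linarith, by linarith, by linarith, by linarith [hj.2]⟩
    refine le_antisymm ?_ e1
    by_contra! hlt
    obtain ⟨m, hm, -⟩ := hc.side_bot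
    have := hyb m (by linarith)
    linarith
  subst ha hc'
  exact ⟨a', c', hc⟩

/-- Every rectangular face is determined by its lower left corner. -/
theorem ncard_rectangles [Finite ι] (h : IsArrangement N B) :
    {F : Set (ℝ × ℝ) | IsFace (⋃ i, (B i).toSet) F ∧ IsRectangle F}.ncard
      = (corners B).ncard := by
  choose f g hfg using fun (k : ℝ × ℝ) (hk : k ∈ corners B) => h.exists_isCell_of_mem_corners hk
  symm
  refine Set.ncard_congr (fun k hk => Set.Ioo k.1 (f k hk) ×ˢ Set.Ioo k.2 (g k hk)) ?_ ?_ ?_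
  · exact fun k hk => ⟨(hfg k hk).isFace, (hfg k hk).isRectangle⟩
  · intro k k' hk hk' heq
    have h1 := (hfg k hk).lt_x
    have h2 := (hfg k hk).lt_y
    have h3 := (hfg k' hk').lt_x
    have h4 := (hfg k' hk').lt_y
    -- A corner is the least point of its closed rectangle, so equal rectangles have equal corners.
    have e := congrArg closure heq
    rw [closure_prod_eq, closure_prod_eq, closure_Ioo h1.ne, closure_Ioo h2.ne, closure_Ioo h3.ne,
      closure_Ioo h4.ne] at e
    have m1 : k ∈ Set.Icc k'.1 (f k' hk') ×ˢ Set.Icc k'.2 (g k' hk') :=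
      e ▸ ⟨⟨le_rfl, h1.le⟩, le_rfl, h2.le⟩
    have m2 : k' ∈ Set.Icc k.1 (f k hk) ×ˢ Set.Icc k.2 (g k hk) :=
      e ▸ ⟨⟨le_rfl, h3.le⟩, le_rfl, h4.le⟩
    exact Prod.ext (le_antisymm m2.1.1 m1.1.1) (le_antisymm m2.2.1 m1.2.1)
  · rintro F ⟨hF, hR⟩
    obtain ⟨a, a', c, c', hc, rfl⟩ := h.exists_isCell_of_isBounded hF hR.isBounded
    have hk := hc.mem_corners
    refine ⟨(a, c), hk, ?_⟩
    -- Two cells with the same lower left corner overlap near it, and overlapping faces are equal.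
    have hx := lt_min hc.lt_x (hfg _ hk).lt_x
    have hy := lt_min hc.lt_y (hfg _ hk).lt_y
    obtain ⟨x, hx1, hx2⟩ := exists_between hx
    obtain ⟨y, hy1, hy2⟩ := exists_between hy
    rw [lt_min_iff] at hx2 hy2
    exact (hfg _ hk).isFace.eq_of_mem hF (p := (x, y)) ⟨⟨hx1, hx2.2⟩, hy1, hy2.2⟩
      ⟨⟨hx1, hx2.1⟩, hy1, hy2.1⟩

end IsArrangement

/-! ### The final configuration of the growth from points in general position -/

/-- The points of the finite set `V` lie inside the open square, and no two of them are on a line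
parallel to a coordinate axis or to one of the two diagonals. -/
structure IsGeneric (N : ℝ) (V : Set (ℝ × ℝ)) : Prop where
  finite : V.Finite
  mem_x : ∀ u ∈ V, u.1 ∈ Set.Ioo 0 N
  mem_y : ∀ u ∈ V, u.2 ∈ Set.Ioo 0 N
  inj_x : Set.InjOn (fun u : ℝ × ℝ => u.1) V
  inj_y : Set.InjOn (fun u : ℝ × ℝ => u.2) V
  inj_add : Set.InjOn (fun u : ℝ × ℝ => u.2 + u.1) V
  inj_sub : Set.InjOn (fun u : ℝ × ℝ => u.2 - u.1) V

theorem Direction.eq_of_ne_of_ne {a b c : Direction} (h : a ≠ b) (h' : b ≠ c) : a = c := by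
  cases a <;> cases b <;> cases c <;> simp_all

/-! ### Meetings of half-lines from points in general position. -/

section Tip

variable {d : ℝ × ℝ → Direction} {u : ℝ × ℝ}

theorem tip_hor (h : d u = .horizontal) (s : ℤˣ) (t : ℝ) :
    tip d (u, s) t = (u.1 + ((s : ℤ) : ℝ) * t, u.2) := by
  ext <;> simp [tip, h, Direction.vec]

theorem tip_ver (h : d u = .vertical) (s : ℤˣ) (t : ℝ) :
    tip d (u, s) t = (u.1, u.2 + ((s : ℤ) : ℝ) * t) := by
  ext <;> simp [tip, h, Direction.vec]

theorem tip_eq_same {s s' : ℤˣ} {t x : ℝ} (ht : 0 ≤ t) (hx : 0 ≤ x)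
    (h : tip d (u, s) t = tip d (u, s') x) : t = x ∧ (s = s' ∨ t = 0) := by
  have hst : ((s : ℤ) : ℝ) * t = ((s' : ℤ) : ℝ) * x := by
    cases hu : d u
    · simpa [tip_hor hu] using h
    · simpa [tip_ver hu] using h
  rcases Int.units_eq_one_or s with rfl | rfl <;> rcases Int.units_eq_one_or s' with rfl | rfl <;>
    simp at hst ⊢
  · exact hst
  · exact ⟨by linarith, by linarith⟩
  · exact ⟨by linarith, by linarith⟩
  · exact hst

end Tip

namespace IsGeneric

variable {N : ℝ} {V : Set (ℝ × ℝ)} {d : ℝ × ℝ → Direction}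

theorem eq_of_parallel (hV : IsGeneric N V) {r r' : Ray} (hr : r.1 ∈ V) (hr' : r'.1 ∈ V)
    (hd : d r.1 = d r'.1) {t x : ℝ} (h : tip d r t = tip d r' x) : r.1 = r'.1 := by
  obtain ⟨u, s⟩ := r
  obtain ⟨v, s'⟩ := r'
  cases hu : d u
  · rw [tip_hor hu, tip_hor (hd ▸ hu)] at h
    exact hV.inj_y hr hr' (Prod.ext_iff.1 h).2
  · rw [tip_ver hu, tip_ver (hd ▸ hu)] at h
    exact hV.inj_x hr hr' (Prod.ext_iff.1 h).1

/-- Parallel rays that meet start at the same point, and the two opposite rays from one point share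
only that point, at time `0`. -/
theorem not_parallel (hV : IsGeneric N V) {r r' : Ray} (hr : r.1 ∈ V) (hr' : r'.1 ∈ V)
    (hne : r' ≠ r) {t x : ℝ} (ht : 0 < t) (hx : 0 ≤ x) (h : tip d r t = tip d r' x) :
    d r.1 ≠ d r'.1 := by
  intro hd
  have he := hV.eq_of_parallel hr hr' hd h
  obtain ⟨u, s⟩ := r
  obtain ⟨v, s'⟩ := r'
  obtain rfl : u = v := he
  rcases tip_eq_same ht.le hx h with ⟨-, rfl | h0⟩
  · exact hne rfl
  · exact ht.ne' h0

theorem meeting_of_perp (hV : IsGeneric N V) {r r' : Ray} (hr : r.1 ∈ V) (hr' : r'.1 ∈ V)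
    (hd : d r.1 ≠ d r'.1) {t x : ℝ} (ht : 0 ≤ t) (hx : 0 ≤ x) (h : tip d r t = tip d r' x) :
    0 < t ∧ 0 < x ∧ t ≠ x := by
  have key : ∀ u s v s' t x, u ∈ V → v ∈ V → d u = .horizontal → d v = .vertical →
      tip d (u, s) t = tip d (v, s') x → t ≠ 0 ∧ x ≠ 0 ∧ t ≠ x := by
    intro u s v s' t x hu hv hdu hdv h
    have hne : u ≠ v := by
      rintro rfl
      rw [hdu] at hdv
      cases hdv
    rw [tip_hor hdu, tip_ver hdv, Prod.mk.injEq] at h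
    refine ⟨?_, ?_, ?_⟩
    · rintro rfl
      exact hne (hV.inj_x hu hv (by simpa using h.1))
    · rintro rfl
      exact hne (hV.inj_y hu hv (by simpa using h.2))
    -- With equal times the starting points differ by `(±t, ±t)`, so they lie on a common diagonal
    -- line.
    · rintro rfl
      rcases Int.units_eq_one_or s with rfl | rfl <;>
        rcases Int.units_eq_one_or s' with rfl | rfl <;> simp at h
      · exact hne (hV.inj_add hu hv (by dsimp only; linarith))
      · exact hne (hV.inj_sub hu hv (by dsimp only; linarith))
      · exact hne (hV.inj_sub hu hv (by dsimp only; linarith))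
      · exact hne (hV.inj_add hu hv (by dsimp only; linarith))
  suffices t ≠ 0 ∧ x ≠ 0 ∧ t ≠ x from
    ⟨lt_of_le_of_ne ht this.1.symm, lt_of_le_of_ne hx this.2.1.symm, this.2.2⟩
  cases hu : d r.1 <;> cases hv : d r'.1
  · exact absurd (hu.trans hv.symm) hd
  · exact key _ _ _ _ _ _ hr hr' hu hv h
  · have := key _ _ _ _ _ _ hr' hr hv hu h.symm
    exact ⟨this.2.1, this.1, this.2.2.symm⟩
  · exact absurd (hu.trans hv.symm) hd

/-- A half-line from a point of the open square leaves the square at a certain point. -/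
theorem exists_exit (hV : IsGeneric N V) {r : Ray} (hr : r.1 ∈ V) :
    ∃ D : ℝ, 0 < D ∧ D < N ∧ ∀ t : ℝ, 0 ≤ t →
      (t ≤ D ↔ tip d r t ∈ square N) ∧
      (t < D ↔ tip d r t ∈ Set.Ioo 0 N ×ˢ Set.Ioo 0 N) := by
  obtain ⟨u, s⟩ := r
  obtain ⟨hx0, hxN⟩ := hV.mem_x u hr
  obtain ⟨hy0, hyN⟩ := hV.mem_y u hr
  cases hu : d u <;> rcases Int.units_eq_one_or s with rfl | rfl
  · refine ⟨N - u.1, by linarith, by linarith, fun t ht => ?_⟩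
    simp only [tip_hor hu, square, Set.mem_prod, Set.mem_Icc, Set.mem_Ioo]
    constructor <;> constructor <;> intro h <;> push_cast at * <;>
      first
      | exact ⟨⟨by linarith, by linarith⟩, by linarith, by linarith⟩
      | linarith [h.1.2]
  · refine ⟨u.1, by linarith, by linarith, fun t ht => ?_⟩
    simp only [tip_hor hu, square, Set.mem_prod, Set.mem_Icc, Set.mem_Ioo]
    constructor <;> constructor <;> intro h <;> push_cast at * <;>
      first
      | exact ⟨⟨by linarith, by linarith⟩, by linarith, by linarith⟩
      | linarith [h.1.1]
  · refine ⟨N - u.2, by linarith, by linarith, fun t ht => ?_⟩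
    simp only [tip_ver hu, square, Set.mem_prod, Set.mem_Icc, Set.mem_Ioo]
    constructor <;> constructor <;> intro h <;> push_cast at * <;>
      first
      | exact ⟨⟨by linarith, by linarith⟩, by linarith, by linarith⟩
      | linarith [h.2.2]
  · refine ⟨u.2, by linarith, by linarith, fun t ht => ?_⟩
    simp only [tip_ver hu, square, Set.mem_prod, Set.mem_Icc, Set.mem_Ioo]
    constructor <;> constructor <;> intro h <;> push_cast at * <;>
      first
      | exact ⟨⟨by linarith, by linarith⟩, by linarith, by linarith⟩
      | linarith [h.2.1]

end IsGeneric

/-- `ρ r` is the length of the part of the ray `r` in the square, in the final configuration of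
the growth from `V`. -/
structure IsReach (V : Set (ℝ × ℝ)) (d : ℝ × ℝ → Direction) (N : ℝ) (ρ : Ray → ℝ) : Prop where
  pos : ∀ r, r.1 ∈ V → 0 < ρ r
  lt_side : ∀ r, r.1 ∈ V → ρ r < N
  le_iff : ∀ r, r.1 ∈ V → ∀ t : ℝ, 0 ≤ t →
    (t ≤ ρ r ↔ (t : EReal) ≤ stopTime V d r ∧ tip d r t ∈ square N)
  lt_iff : ∀ r, r.1 ∈ V → ∀ t : ℝ, 0 ≤ t →
    (t < ρ r ↔ (t : EReal) < stopTime V d r ∧ tip d r t ∈ Set.Ioo 0 N ×ˢ Set.Ioo 0 N)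

theorem IsGeneric.exists_isReach {N : ℝ} {V : Set (ℝ × ℝ)} (hV : IsGeneric N V)
    (d : ℝ × ℝ → Direction) : ∃ ρ, IsReach V d N ρ := by
  have hτ : ∀ r : Ray, r.1 ∈ V → 0 < stopTime V d r := by
    intro r hr
    rcases isGrowth_stopTime hV.finite d r hr with ⟨-, h⟩ | ⟨t, ht, hl⟩
    · rw [h]
      exact EReal.zero_lt_top
    · rw [ht]
      exact EReal.coe_pos.2 hl.1.1
  have key : ∀ r : Ray, ∃ m : ℝ, r.1 ∈ V → 0 < m ∧ m < N ∧ ∀ t : ℝ, 0 ≤ t →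
      (t ≤ m ↔ (t : EReal) ≤ stopTime V d r ∧ tip d r t ∈ square N) ∧
      (t < m ↔ (t : EReal) < stopTime V d r ∧ tip d r t ∈ Set.Ioo 0 N ×ˢ Set.Ioo 0 N) := by
    intro r
    by_cases hr : r.1 ∈ V
    · obtain ⟨D, hD0, hDN, hD⟩ := hV.exists_exit (d := d) hr
      -- The reach is the smaller of the stopping time and the exit distance `D`; it is finite
      -- because `D` is.
      have hmin : 0 < min (stopTime V d r) (D : EReal) := lt_min (hτ r hr) (EReal.coe_pos.2 hD0)
      obtain ⟨m, hm⟩ : ∃ m : ℝ, (m : EReal) = min (stopTime V d r) (D : EReal) :=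
        ⟨_, EReal.coe_toReal ((min_le_right _ _).trans_lt (EReal.coe_lt_top D)).ne
          (EReal.bot_lt_zero.trans hmin).ne'⟩
      refine ⟨m, fun _ => ⟨?_, ?_, fun t ht => ⟨?_, ?_⟩⟩⟩
      · rw [← hm] at hmin
        exact EReal.coe_pos.1 hmin
      · exact (EReal.coe_le_coe_iff.1 (hm.le.trans (min_le_right _ _))).trans_lt hDN
      · rw [← (hD t ht).1, ← EReal.coe_le_coe_iff, hm, le_min_iff, EReal.coe_le_coe_iff]
      · rw [← (hD t ht).2, ← EReal.coe_lt_coe_iff, hm, lt_min_iff, EReal.coe_lt_coe_iff]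
    · exact ⟨0, fun h => absurd h hr⟩
  choose ρ hρ using key
  exact ⟨ρ, fun r hr => (hρ r hr).1, fun r hr => (hρ r hr).2.1,
    fun r hr t ht => ((hρ r hr).2.2 t ht).1, fun r hr t ht => ((hρ r hr).2.2 t ht).2⟩

/-! ### How the grown rays block each other. -/

namespace IsReach

variable {N : ℝ} {V : Set (ℝ × ℝ)} {d : ℝ × ℝ → Direction} {ρ : Ray → ℝ}

/-- A ray that ends in the open square ends inside a perpendicular ray. -/
theorem exists_blocking (h : IsReach V d N ρ) (hV : IsGeneric N V) {r : Ray} (hr : r.1 ∈ V)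
    (hin : tip d r (ρ r) ∈ Set.Ioo 0 N ×ˢ Set.Ioo 0 N) :
    ∃ r' : Ray, r'.1 ∈ V ∧ d r.1 ≠ d r'.1 ∧
      ∃ x, 0 ≤ x ∧ x < ρ r' ∧ tip d r (ρ r) = tip d r' x := by
  have hgr := isGrowth_stopTime hV.finite d
  have hpos := h.pos r hr
  -- The ray ends before the frontier of the square, so it was stopped by another ray.
  have hτ : stopTime V d r = (ρ r : EReal) := by
    refine le_antisymm ?_ ((h.le_iff r hr _ hpos.le).1 le_rfl).1
    by_contra! hlt
    exact lt_irrefl _ ((h.lt_iff r hr _ hpos.le).2 ⟨hlt, hin⟩)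
  rcases hgr r hr with ⟨-, h1⟩ | ⟨t, ht, ⟨ht0, r', hr', hne, x, ⟨hx0, hxt, hxτ⟩, hx⟩, -⟩
  · rw [hτ] at h1
    exact absurd h1 (EReal.coe_ne_top _)
  · obtain rfl : ρ r = t := EReal.coe_injective (hτ.symm.trans ht)
    have hd := hV.not_parallel hr hr' hne ht0 hx0 hx.symm
    obtain ⟨-, hx0', hxne⟩ := hV.meeting_of_perp hr hr' hd ht0.le hx0 hx.symm
    refine ⟨r', hr', hd, x, hx0, (h.lt_iff r' hr' x hx0).2 ⟨lt_of_le_of_ne hxτ ?_, hx ▸ hin⟩,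
      hx.symm⟩
    -- If `r'` itself stopped at this point, it was stopped by a ray `r''` perpendicular to it,
    -- hence parallel to `r` and through the same point. Then `r''` starts where `r` does and
    -- arrives after the same time, which forces `t = x`, excluded by general position.
    intro hxe
    rcases hgr r' hr' with ⟨-, h1⟩ | ⟨t', ht', ⟨-, r'', hr'', hne', y, ⟨hy0, hyt, -⟩, hy⟩, -⟩
    · rw [← hxe] at h1
      exact EReal.coe_ne_top _ h1
    · obtain rfl : x = t' := EReal.coe_injective (hxe.trans ht')
      have hd' := hV.not_parallel hr' hr'' hne' hx0' hy0 hy.symm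
      have hd'' : d r.1 = d r''.1 := Direction.eq_of_ne_of_ne hd hd'
      have he := hx.symm.trans hy.symm
      have hrr := hV.eq_of_parallel hr hr'' hd'' he
      obtain ⟨u, s⟩ := r
      obtain ⟨u'', s''⟩ := r''
      obtain rfl : u = u'' := hrr
      have hty := (tip_eq_same ht0.le hy0 he).1
      exact hxne (le_antisymm (hty.trans_le hyt) hxt)

/-- Perpendicular rays do not cross. -/
theorem eq_or_eq_of_tip_eq (h : IsReach V d N ρ) (hV : IsGeneric N V) {r r' : Ray}
    (hr : r.1 ∈ V) (hr' : r'.1 ∈ V) (hd : d r.1 ≠ d r'.1) {t x : ℝ} (ht : 0 ≤ t) (hx : 0 ≤ x)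
    (htr : t ≤ ρ r) (hxr : x ≤ ρ r') (heq : tip d r t = tip d r' x) : t = ρ r ∨ x = ρ r' := by
  -- A ray that continues beyond the common point cannot have arrived there after the other one.
  -- Applied to both rays, this gives equal times, again excluded.
  have key : ∀ (r r' : Ray) (t x : ℝ), r.1 ∈ V → r'.1 ∈ V → d r.1 ≠ d r'.1 → 0 ≤ t → 0 ≤ x →
      t < ρ r → x ≤ ρ r' → tip d r t = tip d r' x → t ≤ x := by
    intro r r' t x hr hr' hd ht hx htr hxr heq
    by_contra! hlt
    have h1 := ((h.lt_iff r hr t ht).1 htr).1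
    have h2 := ((h.le_iff r' hr' x hx).1 hxr).1
    have hit : t ∈ hitTimes V d (stopTime V d) r :=
      ⟨hx.trans_lt hlt, r', hr', fun he => hd (by rw [he]), x, ⟨hx, hlt.le, h2⟩, heq.symm⟩
    rcases isGrowth_stopTime hV.finite d r hr with ⟨h3, -⟩ | ⟨t', ht', hl⟩
    · rw [h3] at hit
      exact hit
    · rw [ht'] at h1
      exact absurd (hl.2 hit) (not_le.2 (EReal.coe_lt_coe_iff.1 h1))
  by_contra! hcon
  have h1 := key r r' t x hr hr' hd ht hx (lt_of_le_of_ne htr hcon.1) hxr heq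
  have h2 := key r' r x t hr' hr hd.symm hx ht (lt_of_le_of_ne hxr hcon.2) htr heq.symm
  exact (hV.meeting_of_perp hr hr' hd ht hx heq).2.2 (le_antisymm h1 h2)

end IsReach

/-- The segment formed by the two rays from `u`, if `ρ` gives the lengths of the rays. -/
def segment (d : ℝ × ℝ → Direction) (ρ : Ray → ℝ) (u : ℝ × ℝ) : Box :=
  match d u with
  | .horizontal => ⟨u.1 - ρ (u, -1), u.1 + ρ (u, 1), u.2, u.2⟩
  | .vertical => ⟨u.1, u.1, u.2 - ρ (u, -1), u.2 + ρ (u, 1)⟩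

section Segment

variable {d : ℝ × ℝ → Direction} {ρ : Ray → ℝ} {u : ℝ × ℝ}

theorem segment_hor (h : d u = .horizontal) :
    segment d ρ u = ⟨u.1 - ρ (u, -1), u.1 + ρ (u, 1), u.2, u.2⟩ := by
  simp [segment, h]

theorem segment_ver (h : d u = .vertical) :
    segment d ρ u = ⟨u.1, u.1, u.2 - ρ (u, -1), u.2 + ρ (u, 1)⟩ := by
  simp [segment, h]

theorem exists_signed_le {f : ℤˣ → ℝ} (hf : ∀ s, 0 < f s) {y b : ℝ} :
    (∃ (s : ℤˣ) (t : ℝ), 0 ≤ t ∧ t ≤ f s ∧ y + ((s : ℤ) : ℝ) * t = b) ↔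
      y - f (-1) ≤ b ∧ b ≤ y + f 1 := by
  have h1 := hf 1
  have h2 := hf (-1)
  constructor
  · rintro ⟨s, t, h0, ht, rfl⟩
    rcases Int.units_eq_one_or s with rfl | rfl <;> push_cast <;> constructor <;> linarith
  · rintro ⟨h3, h4⟩
    rcases le_total y b with h | h
    · exact ⟨1, b - y, by linarith, by linarith, by push_cast; ring⟩
    · exact ⟨-1, y - b, by linarith, by linarith, by push_cast; ring⟩

theorem exists_signed_lt {f : ℤˣ → ℝ} (hf : ∀ s, 0 < f s) {y b : ℝ} :
    (∃ (s : ℤˣ) (t : ℝ), 0 ≤ t ∧ t < f s ∧ y + ((s : ℤ) : ℝ) * t = b) ↔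
      y - f (-1) < b ∧ b < y + f 1 := by
  have h1 := hf 1
  have h2 := hf (-1)
  constructor
  · rintro ⟨s, t, h0, ht, rfl⟩
    rcases Int.units_eq_one_or s with rfl | rfl <;> push_cast <;> constructor <;> linarith
  · rintro ⟨h3, h4⟩
    rcases le_total y b with h | h
    · exact ⟨1, b - y, by linarith, by linarith, by push_cast; ring⟩
    · exact ⟨-1, y - b, by linarith, by linarith, by push_cast; ring⟩

theorem mem_segment_iff (hρ : ∀ s, 0 < ρ (u, s)) (p : ℝ × ℝ) :
    p ∈ (segment d ρ u).toSet ↔ ∃ (s : ℤˣ) (t : ℝ), 0 ≤ t ∧ t ≤ ρ (u, s) ∧ tip d (u, s) t = p := by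
  cases hu : d u
  · simp only [segment_hor hu, tip_hor hu, Box.toSet, Set.mem_prod, Set.mem_Icc, Prod.ext_iff,
      ← exists_signed_le hρ]
    constructor
    · rintro ⟨⟨s, t, h1, h2, h3⟩, h4, h5⟩
      exact ⟨s, t, h1, h2, h3, le_antisymm h4 h5⟩
    · rintro ⟨s, t, h1, h2, h3, h4⟩
      exact ⟨⟨s, t, h1, h2, h3⟩, h4.le, h4.ge⟩
  · simp only [segment_ver hu, tip_ver hu, Box.toSet, Set.mem_prod, Set.mem_Icc, Prod.ext_iff,
      ← exists_signed_le hρ]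
    constructor
    · rintro ⟨⟨h4, h5⟩, s, t, h1, h2, h3⟩
      exact ⟨s, t, h1, h2, le_antisymm h4 h5, h3⟩
    · rintro ⟨s, t, h1, h2, h3, h4⟩
      exact ⟨⟨h3.le, h3.ge⟩, s, t, h1, h2, h4⟩

end Segment

/-- The four sides of the square. -/
def sides (N : ℝ) : Fin 4 → Box := ![⟨0, 0, 0, N⟩, ⟨N, N, 0, N⟩, ⟨0, N, 0, 0⟩, ⟨0, N, N, N⟩]

theorem sides_cases (N : ℝ) (k : Fin 4) : sides N k = ⟨0, 0, 0, N⟩ ∨ sides N k = ⟨N, N, 0, N⟩ ∨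
    sides N k = ⟨0, N, 0, 0⟩ ∨ sides N k = ⟨0, N, N, N⟩ := by
  fin_cases k <;> simp [sides]

/-- The segments grown from `V` together with the sides of the square. -/
def finalSegments (V : Set (ℝ × ℝ)) (d : ℝ × ℝ → Direction) (N : ℝ) (ρ : Ray → ℝ) :
    V ⊕ Fin 4 → Box :=
  Sum.elim (fun u => segment d ρ u) (sides N)

/-! ### The final configuration is an arrangement. -/

namespace IsReach

variable {N : ℝ} {V : Set (ℝ × ℝ)} {d : ℝ × ℝ → Direction} {ρ : Ray → ℝ}

theorem bounds_hor (h : IsReach V d N ρ) {u : ℝ × ℝ} (hu : u ∈ V) (hdu : d u = .horizontal) :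
    0 ≤ u.1 - ρ (u, -1) ∧ u.1 + ρ (u, 1) ≤ N := by
  have h1 := ((h.le_iff (u, 1) hu _ (h.pos _ hu).le).1 le_rfl).2
  have h2 := ((h.le_iff (u, -1) hu _ (h.pos _ hu).le).1 le_rfl).2
  rw [tip_hor hdu] at h1 h2
  have h3 := h1.1.2
  have h4 := h2.1.1
  push_cast at h3 h4
  constructor <;> linarith

theorem bounds_ver (h : IsReach V d N ρ) {u : ℝ × ℝ} (hu : u ∈ V) (hdu : d u = .vertical) :
    0 ≤ u.2 - ρ (u, -1) ∧ u.2 + ρ (u, 1) ≤ N := by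
  have h1 := ((h.le_iff (u, 1) hu _ (h.pos _ hu).le).1 le_rfl).2
  have h2 := ((h.le_iff (u, -1) hu _ (h.pos _ hu).le).1 le_rfl).2
  rw [tip_ver hdu] at h1 h2
  have h3 := h1.2.2
  have h4 := h2.2.1
  push_cast at h3 h4
  constructor <;> linarith

/-- Translates `exists_blocking` from rays to segments: the blocking point is before the end of the
blocking ray, hence in the interior of the segment made of both rays. -/
theorem exists_end_hor (h : IsReach V d N ρ) (hV : IsGeneric N V) {u : ℝ × ℝ} (hu : u ∈ V)
    (hdu : d u = .horizontal) (s : ℤˣ) {b : ℝ} (hb : u.1 + ((s : ℤ) : ℝ) * ρ (u, s) = b)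
    (hb0 : 0 < b) (hbN : b < N) :
    ∃ v ∈ V, d v = .vertical ∧ v.1 = b ∧ v.2 - ρ (v, -1) < u.2 ∧ u.2 < v.2 + ρ (v, 1) := by
  obtain ⟨⟨v, s'⟩, hv, hd, x, hx0, hx, heq⟩ := h.exists_blocking hV (r := (u, s)) hu
    (by rw [tip_hor hdu, hb]; exact ⟨⟨hb0, hbN⟩, hV.mem_y u hu⟩)
  have hdv : d v = .vertical := by
    cases hdv : d v
    · exact absurd (hdu.trans hdv.symm) hd
    · rfl
  rw [tip_hor hdu, tip_ver hdv, hb, Prod.mk.injEq] at heq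
  exact ⟨v, hv, hdv, heq.1.symm,
    (exists_signed_lt (f := fun s => ρ (v, s)) fun s => h.pos (v, s) hv).1
      ⟨s', x, hx0, hx, heq.2.symm⟩⟩

theorem exists_end_ver (h : IsReach V d N ρ) (hV : IsGeneric N V) {u : ℝ × ℝ} (hu : u ∈ V)
    (hdu : d u = .vertical) (s : ℤˣ) {b : ℝ} (hb : u.2 + ((s : ℤ) : ℝ) * ρ (u, s) = b)
    (hb0 : 0 < b) (hbN : b < N) :
    ∃ v ∈ V, d v = .horizontal ∧ v.2 = b ∧ v.1 - ρ (v, -1) < u.1 ∧ u.1 < v.1 + ρ (v, 1) := by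
  obtain ⟨⟨v, s'⟩, hv, hd, x, hx0, hx, heq⟩ := h.exists_blocking hV (r := (u, s)) hu
    (by rw [tip_ver hdu, hb]; exact ⟨hV.mem_x u hu, hb0, hbN⟩)
  have hdv : d v = .horizontal := by
    cases hdv : d v
    · rfl
    · exact absurd (hdu.trans hdv.symm) hd
  rw [tip_ver hdu, tip_hor hdv, hb, Prod.mk.injEq] at heq
  exact ⟨v, hv, hdv, heq.2.symm,
    (exists_signed_lt (f := fun s => ρ (v, s)) fun s => h.pos (v, s) hv).1
      ⟨s', x, hx0, hx, heq.1.symm⟩⟩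

theorem not_cross (h : IsReach V d N ρ) (hV : IsGeneric N V) {u v : ℝ × ℝ} (hu : u ∈ V)
    (hv : v ∈ V) (hdu : d u = .horizontal) (hdv : d v = .vertical)
    (h1 : u.1 - ρ (u, -1) < v.1 ∧ v.1 < u.1 + ρ (u, 1))
    (h2 : v.2 - ρ (v, -1) < u.2 ∧ u.2 < v.2 + ρ (v, 1)) : False := by
  obtain ⟨s, t, ht0, ht, hte⟩ :=
    (exists_signed_lt (f := fun s => ρ (u, s)) fun s => h.pos (u, s) hu).2 h1
  obtain ⟨s', x, hx0, hx, hxe⟩ :=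
    (exists_signed_lt (f := fun s => ρ (v, s)) fun s => h.pos (v, s) hv).2 h2
  rcases h.eq_or_eq_of_tip_eq hV (r := (u, s)) (r' := (v, s')) hu hv
    (by rw [hdu, hdv]; simp) ht0 hx0 ht.le hx.le
    (by rw [tip_hor hdu, tip_ver hdv, hte, hxe]) with h3 | h3
  · exact ht.ne h3
  · exact hx.ne h3

theorem isArrangement (h : IsReach V d N ρ) (hV : IsGeneric N V) (hN : 0 < N) :
    IsArrangement N (finalSegments V d N ρ) where
  isHor_or_isVer := by
    rintro (⟨u, hu⟩ | k)
    · have h1 := h.pos (u, 1) hu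
      have h2 := h.pos (u, -1) hu
      cases hdu : d u
      · left
        simp only [finalSegments, Sum.elim_inl, segment_hor hdu, Box.IsHor]
        exact ⟨by linarith, trivial⟩
      · right
        simp only [finalSegments, Sum.elim_inl, segment_ver hdu, Box.IsVer]
        exact ⟨trivial, by linarith⟩
    · rcases sides_cases N k with hk | hk | hk | hk <;>
        simp [finalSegments, hk, Box.IsHor, Box.IsVer, hN]
  left_nonneg := by
    rintro (⟨u, hu⟩ | k)
    · cases hdu : d u
      · simpa [finalSegments, segment_hor hdu] using (h.bounds_hor hu hdu).1
      · simpa [finalSegments, segment_ver hdu] using (hV.mem_x u hu).1.le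
    · rcases sides_cases N k with hk | hk | hk | hk <;> simp [finalSegments, hk, hN.le]
  right_le := by
    rintro (⟨u, hu⟩ | k)
    · cases hdu : d u
      · simpa [finalSegments, segment_hor hdu] using (h.bounds_hor hu hdu).2
      · simpa [finalSegments, segment_ver hdu] using (hV.mem_x u hu).2.le
    · rcases sides_cases N k with hk | hk | hk | hk <;> simp [finalSegments, hk, hN.le]
  bot_nonneg := by
    rintro (⟨u, hu⟩ | k)
    · cases hdu : d u
      · simpa [finalSegments, segment_hor hdu] using (hV.mem_y u hu).1.le
      · simpa [finalSegments, segment_ver hdu] using (h.bounds_ver hu hdu).1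
    · rcases sides_cases N k with hk | hk | hk | hk <;> simp [finalSegments, hk, hN.le]
  top_le := by
    rintro (⟨u, hu⟩ | k)
    · cases hdu : d u
      · simpa [finalSegments, segment_hor hdu] using (hV.mem_y u hu).2.le
      · simpa [finalSegments, segment_ver hdu] using (h.bounds_ver hu hdu).2
    · rcases sides_cases N k with hk | hk | hk | hk <;> simp [finalSegments, hk, hN.le]
  end_left := by
    rintro (⟨u, hu⟩ | k) h1 h2
    · cases hdu : d u
      · simp only [finalSegments, Sum.elim_inl, segment_hor hdu] at h2 ⊢
        have h3 := h.pos (u, -1) hu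
        obtain ⟨v, hv, hdv, e1, e2, e3⟩ := h.exists_end_hor hV hu hdu (-1) (b := u.1 - ρ (u, -1))
          (by push_cast; ring) h2 (by linarith [(hV.mem_x u hu).2])
        refine ⟨.inl ⟨v, hv⟩, ?_⟩
        simp only [Sum.elim_inl, segment_ver hdv, Box.IsVer]
        exact ⟨⟨trivial, by linarith⟩, e1, e2, e3⟩
      · simp [finalSegments, segment_ver hdu, Box.IsHor] at h1
    · rcases sides_cases N k with hk | hk | hk | hk <;>
        simp [finalSegments, hk, Box.IsHor] at h1 h2
  end_right := by
    rintro (⟨u, hu⟩ | k) h1 h2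
    · cases hdu : d u
      · simp only [finalSegments, Sum.elim_inl, segment_hor hdu] at h2 ⊢
        have h3 := h.pos (u, 1) hu
        obtain ⟨v, hv, hdv, e1, e2, e3⟩ := h.exists_end_hor hV hu hdu 1 (b := u.1 + ρ (u, 1))
          (by push_cast; ring) (by linarith [(hV.mem_x u hu).1]) h2
        refine ⟨.inl ⟨v, hv⟩, ?_⟩
        simp only [Sum.elim_inl, segment_ver hdv, Box.IsVer]
        exact ⟨⟨trivial, by linarith⟩, e1, e2, e3⟩
      · simp [finalSegments, segment_ver hdu, Box.IsHor] at h1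
    · rcases sides_cases N k with hk | hk | hk | hk <;>
        simp [finalSegments, hk, Box.IsHor] at h1 h2
  end_bot := by
    rintro (⟨u, hu⟩ | k) h1 h2
    · cases hdu : d u
      · simp [finalSegments, segment_hor hdu, Box.IsVer] at h1
      · simp only [finalSegments, Sum.elim_inl, segment_ver hdu] at h2 ⊢
        have h3 := h.pos (u, -1) hu
        obtain ⟨v, hv, hdv, e1, e2, e3⟩ := h.exists_end_ver hV hu hdu (-1) (b := u.2 - ρ (u, -1))
          (by push_cast; ring) h2 (by linarith [(hV.mem_y u hu).2])
        refine ⟨.inl ⟨v, hv⟩, ?_⟩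
        simp only [Sum.elim_inl, segment_hor hdv, Box.IsHor]
        exact ⟨⟨by linarith, trivial⟩, e1, e2, e3⟩
    · rcases sides_cases N k with hk | hk | hk | hk <;>
        simp [finalSegments, hk, Box.IsVer] at h1 h2
  end_top := by
    rintro (⟨u, hu⟩ | k) h1 h2
    · cases hdu : d u
      · simp [finalSegments, segment_hor hdu, Box.IsVer] at h1
      · simp only [finalSegments, Sum.elim_inl, segment_ver hdu] at h2 ⊢
        have h3 := h.pos (u, 1) hu
        obtain ⟨v, hv, hdv, e1, e2, e3⟩ := h.exists_end_ver hV hu hdu 1 (b := u.2 + ρ (u, 1))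
          (by push_cast; ring) (by linarith [(hV.mem_y u hu).1]) h2
        refine ⟨.inl ⟨v, hv⟩, ?_⟩
        simp only [Sum.elim_inl, segment_hor hdv, Box.IsHor]
        exact ⟨⟨by linarith, trivial⟩, e1, e2, e3⟩
    · rcases sides_cases N k with hk | hk | hk | hk <;>
        simp [finalSegments, hk, Box.IsVer] at h1 h2
  not_cross := by
    rintro (⟨u, hu⟩ | k) (⟨v, hv⟩ | m) h1 h2 ⟨h3, h4, h5, h6⟩
    · cases hdu : d u
      · cases hdv : d v
        · simp [finalSegments, segment_hor hdv, Box.IsVer] at h2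
        · simp only [finalSegments, Sum.elim_inl, segment_hor hdu, segment_ver hdv] at h3 h4 h5 h6
          exact h.not_cross hV hu hv hdu hdv ⟨h3, h4⟩ ⟨h5, h6⟩
      · simp [finalSegments, segment_ver hdu, Box.IsHor] at h1
    · cases hdu : d u
      · have h7 := h.bounds_hor hu hdu
        rcases sides_cases N m with hk | hk | hk | hk <;>
          simp [finalSegments, hk, Box.IsVer, segment_hor hdu] at h2 h3 h4 <;> linarith
      · simp [finalSegments, segment_ver hdu, Box.IsHor] at h1
    · cases hdv : d v
      · simp [finalSegments, segment_hor hdv, Box.IsVer] at h2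
      · have h7 := h.bounds_ver hv hdv
        rcases sides_cases N k with hk | hk | hk | hk <;>
          simp [finalSegments, hk, Box.IsHor, segment_ver hdv] at h1 h5 h6 <;> linarith
    · rcases sides_cases N k with hk | hk | hk | hk <;>
        rcases sides_cases N m with hm | hm | hm | hm <;>
        simp [finalSegments, hk, hm, Box.IsHor, Box.IsVer] at h1 h2 h3 h4
  side_left := ⟨.inr 0, rfl⟩
  side_right := ⟨.inr 1, rfl⟩
  side_bot := ⟨.inr 2, rfl⟩
  side_top := ⟨.inr 3, rfl⟩

theorem tessellation_eq (h : IsReach (V ∩ square N) d N ρ) (hN : 0 < N) :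
    tessellation V d N = ⋃ i, (finalSegments (V ∩ square N) d N ρ i).toSet := by
  ext p
  rw [tessellation, Set.mem_union, Set.mem_iUnion, Sum.exists]
  refine or_congr ?_ ?_
  · simp only [finalSegments, Sum.elim_inl, Subtype.exists, grown, rayAt]
    constructor
    · rintro ⟨hp, hps⟩
      simp only [Set.mem_iUnion] at hp
      obtain ⟨⟨u, s⟩, hu, t, ⟨h0, h1, h2⟩, rfl⟩ := hp
      exact ⟨u, hu, (mem_segment_iff (fun s => h.pos (u, s) hu) _).2
        ⟨s, t, h0, (h.le_iff (u, s) hu t h0).2 ⟨h2, hps⟩, rfl⟩⟩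
    · rintro ⟨u, hu, hp⟩
      obtain ⟨s, t, h0, h1, rfl⟩ := (mem_segment_iff (fun s => h.pos (u, s) hu) _).1 hp
      have h2 := (h.le_iff (u, s) hu t h0).1 h1
      refine ⟨?_, h2.2⟩
      simp only [Set.mem_iUnion]
      -- Time `N` is late enough: the part of a ray inside the square is shorter than `N`.
      exact ⟨(u, s), hu, t, ⟨h0, h1.trans (h.lt_side (u, s) hu).le, h2.1⟩, rfl⟩
  · rw [square, frontier_prod_eq, closure_Icc, frontier_Icc hN.le]
    simp only [finalSegments, Sum.elim_inr, Set.mem_union, Set.mem_prod, Set.mem_insert_iff,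
      Set.mem_singleton_iff]
    constructor
    · rintro (⟨h1, h2 | h2⟩ | ⟨h2 | h2, h1⟩)
      · exact ⟨2, h1, h2.ge, h2.le⟩
      · exact ⟨3, h1, h2.ge, h2.le⟩
      · exact ⟨0, ⟨h2.ge, h2.le⟩, h1⟩
      · exact ⟨1, ⟨h2.ge, h2.le⟩, h1⟩
    · rintro ⟨k, hk⟩
      rcases sides_cases N k with e | e | e | e <;> rw [e] at hk
      · exact Or.inr ⟨Or.inl (le_antisymm hk.1.2 hk.1.1), hk.2⟩
      · exact Or.inr ⟨Or.inr (le_antisymm hk.1.2 hk.1.1), hk.2⟩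
      · exact Or.inl ⟨hk.1, Or.inl (le_antisymm hk.2.2 hk.2.1)⟩
      · exact Or.inl ⟨hk.1, Or.inr (le_antisymm hk.2.2 hk.2.1)⟩

end IsReach

/-! ### Counting the lower left corners -/

/-- The lower left corner of a box: the left end of a horizontal segment, and the lower end of a
vertical one. -/
def Box.corner (B : Box) : ℝ × ℝ := (B.left, B.bot)

namespace IsArrangement

variable {ι : Type*} {N : ℝ} {B : ι → Box}

/-- If `k` were interior to both segments that leave it, they would cross. -/
theorem exists_corner_eq (h : IsArrangement N B) {k : ℝ × ℝ} (hk : k ∈ corners B) :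
    ∃ i, (B i).corner = k := by
  obtain ⟨i, j, hi, hj, h1, h2, h3, h4, h5, h6⟩ := hk
  by_cases h7 : (B i).bot = k.2
  · exact ⟨i, Prod.ext h1 h7⟩
  by_cases h8 : (B j).left = k.1
  · exact ⟨j, Prod.ext h8 h4⟩
  have h9 := lt_of_le_of_ne h2 h7
  have h10 := lt_of_le_of_ne h5 h8
  exact absurd ⟨by linarith, by linarith, by linarith, by linarith⟩ (h.not_cross j i hj hi)

theorem lt_of_mem_corners (h : IsArrangement N B) {k : ℝ × ℝ} (hk : k ∈ corners B) :
    k.1 < N ∧ k.2 < N := by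
  obtain ⟨i, j, hi, hj, h1, h2, h3, h4, h5, h6⟩ := hk
  exact ⟨h6.trans_le (h.right_le j), h3.trans_le (h.top_le i)⟩

/-- The left end lies on the left side of the square or inside a vertical segment, and either one
continues upwards because the height is below `N`. -/
theorem corner_mem_of_isHor (h : IsArrangement N B) {i : ι} (hi : (B i).IsHor)
    (hN : (B i).bot < N) : (B i).corner ∈ corners B := by
  rcases (h.left_nonneg i).eq_or_lt with h0 | h0
  · obtain ⟨j, hj⟩ := h.side_left
    refine ⟨j, i, ?_, hi, ?_, ?_, ?_, rfl, le_rfl, hi.1⟩ <;> rw [hj]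
    · exact ⟨rfl, (h.bot_nonneg i).trans_lt hN⟩
    · exact h0
    · exact h.bot_nonneg i
    · exact hN
  · obtain ⟨j, hj, h1, h2, h3⟩ := h.end_left i hi h0
    exact ⟨j, i, hj, hi, h1, h2.le, h3, rfl, le_rfl, hi.1⟩

theorem corner_mem_of_isVer (h : IsArrangement N B) {i : ι} (hi : (B i).IsVer)
    (hN : (B i).left < N) : (B i).corner ∈ corners B := by
  rcases (h.bot_nonneg i).eq_or_lt with h0 | h0
  · obtain ⟨j, hj⟩ := h.side_bot
    refine ⟨i, j, hi, ?_, rfl, le_rfl, hi.2, ?_, ?_, ?_⟩ <;> rw [hj]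
    · exact ⟨(h.left_nonneg i).trans_lt hN, rfl⟩
    · exact h0
    · exact h.left_nonneg i
    · exact hN
  · obtain ⟨j, hj, h1, h2, h3⟩ := h.end_bot i hi h0
    exact ⟨i, j, hi, hj, rfl, le_rfl, hi.2, h1, h2.le, h3⟩

end IsArrangement

namespace IsReach

variable {N : ℝ} {V : Set (ℝ × ℝ)} {d : ℝ × ℝ → Direction} {ρ : Ray → ℝ}

theorem corners_eq (h : IsReach V d N ρ) (hV : IsGeneric N V) (hN : 0 < N) :
    corners (finalSegments V d N ρ) =
      insert (0, 0) ((fun u => (segment d ρ u).corner) '' V) := by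
  have hA := h.isArrangement hV hN
  ext k
  constructor
  · intro hk
    obtain ⟨h1, h2⟩ := hA.lt_of_mem_corners hk
    obtain ⟨⟨u, hu⟩ | m, rfl⟩ := hA.exists_corner_eq hk
    · exact Or.inr ⟨u, hu, rfl⟩
    -- The left and bottom sides both have the corner `(0, 0)`; those of the right and top sides,
    -- `(N, 0)` and `(0, N)`, are ruled out by `h1` and `h2`.
    · rcases sides_cases N m with e | e | e | e <;>
        simp [finalSegments, e, Box.corner] at h1 h2 ⊢
  · rintro (rfl | ⟨u, hu, rfl⟩)
    · exact hA.corner_mem_of_isVer (i := .inr 0) ⟨rfl, hN⟩ hN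
    · cases hdu : d u
      · refine hA.corner_mem_of_isHor (i := .inl ⟨u, hu⟩) ?_ ?_
        · refine (hA.isHor_or_isVer _).resolve_right ?_
          simp [finalSegments, segment_hor hdu, Box.IsVer]
        · simpa [finalSegments, segment_hor hdu] using (hV.mem_y u hu).2
      · refine hA.corner_mem_of_isVer (i := .inl ⟨u, hu⟩) ?_ ?_
        · refine (hA.isHor_or_isVer _).resolve_left ?_
          simp [finalSegments, segment_ver hdu, Box.IsHor]
        · simpa [finalSegments, segment_ver hdu] using (hV.mem_x u hu).2

/-- General position separates parallel segments. A vertical segment ending at the left end of a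
horizontal one would end inside a horizontal segment of the same height, hence inside that very one,
which starts there. -/
theorem injOn_corner (h : IsReach V d N ρ) (hV : IsGeneric N V) :
    Set.InjOn (fun u => (segment d ρ u).corner) V := by
  have key : ∀ u ∈ V, ∀ v ∈ V, d u = .horizontal → d v = .vertical →
      (segment d ρ u).corner ≠ (segment d ρ v).corner := by
    intro u hu v hv hdu hdv heq
    rw [segment_hor hdu, segment_ver hdv, Box.corner, Box.corner, Prod.mk.injEq] at heq
    dsimp only at heq
    obtain ⟨w, hw, hdw, h1, h2, h3⟩ := h.exists_end_ver hV hv hdv (-1) (b := u.2)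
      (by rw [heq.2]; push_cast; ring) (hV.mem_y u hu).1 (hV.mem_y u hu).2
    obtain rfl : w = u := hV.inj_y hw hu h1
    linarith
  intro u hu v hv heq
  dsimp only at heq
  cases hdu : d u <;> cases hdv : d v
  · rw [segment_hor hdu, segment_hor hdv] at heq
    exact hV.inj_y hu hv (Prod.ext_iff.1 heq).2
  · exact absurd heq (key u hu v hv hdu hdv)
  · exact absurd heq.symm (key v hv u hu hdv hdu)
  · rw [segment_ver hdu, segment_ver hdv] at heq
    exact hV.inj_x hu hv (Prod.ext_iff.1 heq).1

theorem ncard_corners (h : IsReach V d N ρ) (hV : IsGeneric N V) (hN : 0 < N) :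
    (corners (finalSegments V d N ρ)).ncard = V.ncard + 1 := by
  rw [h.corners_eq hV hN, Set.ncard_insert_of_notMem _ (hV.finite.image _),
    (h.injOn_corner hV).ncard_image]
  rintro ⟨u, hu, heq⟩
  have h1 := (hV.mem_x u hu).1
  have h2 := (hV.mem_y u hu).1
  cases hdu : d u
  · simp only [segment_hor hdu, Box.corner, Prod.mk.injEq] at heq
    linarith
  · simp only [segment_ver hdu, Box.corner, Prod.mk.injEq] at heq
    linarith

end IsReach

/-- The faces of the tessellation grown from points in general position. -/
theorem IsGeneric.ncard_faces {N : ℝ} {V : Set (ℝ × ℝ)} (hV : IsGeneric N (V ∩ square N))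
    (hN : 0 < N) (d : ℝ × ℝ → Direction) :
    {F : Set (ℝ × ℝ) | IsFace (tessellation V d N) F ∧ IsRectangle F}.ncard
        = (V ∩ square N).ncard + 1 ∧
      ∀ F : Set (ℝ × ℝ), IsFace (tessellation V d N) F → Bornology.IsBounded F →
        IsRectangle F := by
  obtain ⟨ρ, h⟩ := hV.exists_isReach d
  have hA := h.isArrangement hV hN
  have := hV.finite.to_subtype
  rw [h.tessellation_eq hN]
  refine ⟨hA.ncard_rectangles.trans (h.ncard_corners hV hN), fun F hF hb => ?_⟩
  obtain ⟨a, a', c, c', hc, rfl⟩ := hA.exists_isCell_of_isBounded hF hb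
  exact hc.isRectangle

/-! ### The points of a Poisson process are in general position -/

/-- The probability is `1 - exp (-r) * (1 + r)`, and `exp (-r) ≥ 1 - r`. The quadratic order is what
makes the sum over thin strips vanish. -/
theorem poissonMeasure_two_le (r : ℝ≥0) :
    poissonMeasure r {k | 2 ≤ k} ≤ ENNReal.ofReal ((r : ℝ) ^ 2) := by
  have hc : ({k | 2 ≤ k} : Set ℕ)ᶜ = {0} ∪ {1} := by
    ext k
    simp only [Set.mem_compl_iff, Set.mem_ofPred_eq, Set.mem_union, Set.mem_singleton_iff]
    omega
  have h1 : (poissonMeasure r).real {k | 2 ≤ k} =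
      1 - (Real.exp (-r) + Real.exp (-r) * r) := by
    have h2 := probReal_compl_eq_one_sub (μ := poissonMeasure r)
      (MeasurableSet.of_discrete (s := ({k | 2 ≤ k} : Set ℕ)))
    rw [hc, measureReal_union (by simp) MeasurableSet.of_discrete, poissonMeasure_real_singleton,
      poissonMeasure_real_singleton] at h2
    simp at h2
    linarith
  rw [← ofReal_measureReal, h1]
  apply ENNReal.ofReal_le_ofReal
  have h3 := Real.add_one_le_exp (-(r : ℝ))
  nlinarith [r.coe_nonneg]

theorem measurableSet_square (N : ℝ) : MeasurableSet (square N) :=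
  measurableSet_Icc.prod measurableSet_Icc

theorem isBounded_square (N : ℝ) : Bornology.IsBounded (square N) :=
  (Metric.isBounded_Icc 0 N).prod (Metric.isBounded_Icc 0 N)

/-- The part of the square where `f` takes values in `[a, a + h)`. -/
def strip (N : ℝ) (f : ℝ × ℝ → ℝ) (a h : ℝ) : Set (ℝ × ℝ) := square N ∩ f ⁻¹' Set.Ico a (a + h)

theorem volume_strip_fst (N a h : ℝ) :
    volume (strip N (fun p => p.1) a h) ≤ ENNReal.ofReal h * ENNReal.ofReal N := by
  calc volume (strip N (fun p => p.1) a h)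
      ≤ volume (Set.Ico a (a + h) ×ˢ Set.Icc 0 N) := measure_mono fun p hp => ⟨hp.2, hp.1.2⟩
    _ = ENNReal.ofReal h * ENNReal.ofReal N := by
      rw [Measure.volume_eq_prod, Measure.prod_prod]
      simp

theorem measurableSet_strip (N : ℝ) {f : ℝ × ℝ → ℝ} (hf : Measurable f) (a h : ℝ) :
    MeasurableSet (strip N f a h) :=
  (measurableSet_square N).inter (hf measurableSet_Ico)

/-- By Fubini: each vertical section lies in an interval of length `h`. The slopes `c = 0, 1, -1`
serve the horizontal and the two diagonal directions. -/
theorem volume_strip_snd_add (N c a h : ℝ) :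
    volume (strip N (fun p => p.2 + c * p.1) a h) ≤ ENNReal.ofReal h * ENNReal.ofReal N := by
  have hm : MeasurableSet (strip N (fun p => p.2 + c * p.1) a h) :=
    measurableSet_strip N (by fun_prop) a h
  rw [Measure.volume_eq_prod, Measure.prod_apply hm]
  calc ∫⁻ x, volume (Prod.mk x ⁻¹' strip N (fun p => p.2 + c * p.1) a h)
      ≤ ∫⁻ x, (Set.Icc 0 N).indicator (fun _ => ENNReal.ofReal h) x := by
        refine lintegral_mono fun x => ?_
        by_cases hx : x ∈ Set.Icc 0 N
        · rw [Set.indicator_of_mem hx]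
          calc volume (Prod.mk x ⁻¹' strip N (fun p => p.2 + c * p.1) a h)
              ≤ volume (Set.Ico (a - c * x) (a + h - c * x)) := by
                refine measure_mono fun y hy => ?_
                have h1 := hy.2.1
                have h2 := hy.2.2
                dsimp only at h1 h2
                exact ⟨by linarith, by linarith⟩
            _ = ENNReal.ofReal h := by
                rw [Real.volume_Ico]
                congr 1
                ring
        · rw [Set.indicator_of_notMem hx]
          refine (measure_mono_null (t := ∅) (fun y hy => hx hy.1.1) measure_empty).le
    _ = ENNReal.ofReal h * ENNReal.ofReal N := by
        rw [lintegral_indicator measurableSet_Icc]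
        simp

/-! ### Null events of the Poisson process. -/

namespace IsPoissonProcess

variable {Ω : Type*} [MeasurableSpace Ω] {P : Measure Ω} {l : ℝ≥0} {𝒱 : Ω → Set (ℝ × ℝ)}

theorem ae_disjoint_of_volume_eq_zero (h𝒱 : IsPoissonProcess P l 𝒱) {B : Set (ℝ × ℝ)}
    (hB : MeasurableSet B) (hb : Bornology.IsBounded B) (h0 : volume B = 0) :
    ∀ᵐ ω ∂P, 𝒱 ω ∩ B = ∅ := by
  have h1 : ∀ᵐ k ∂(poissonMeasure 0), k = 0 := by
    have h2 := prob_compl_eq_zero_iff (μ := poissonMeasure 0)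
      (MeasurableSet.of_discrete (s := ({0} : Set ℕ)))
    have h3 : poissonMeasure 0 {0} = 1 := by simp [poissonMeasure_singleton]
    exact h2.2 h3
  have h2 := h𝒱.law_count B hB hb
  rw [h0, ENNReal.toNNReal_zero, mul_zero] at h2
  rw [← h2] at h1
  -- Local finiteness is needed because `ncard` is also `0` on infinite sets.
  filter_upwards [ae_of_ae_map (h𝒱.measurable_count B hB hb).aemeasurable h1,
    h𝒱.locallyFinite] with ω hω hfin
  exact (Set.ncard_eq_zero (hfin B hb)).1 hω

theorem prob_two_le (h𝒱 : IsPoissonProcess P l 𝒱) {B : Set (ℝ × ℝ)} (hB : MeasurableSet B)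
    (hb : Bornology.IsBounded B) {c : ℝ} (hc : 0 ≤ c) (hv : volume B ≤ ENNReal.ofReal c) :
    P {ω | 2 ≤ (𝒱 ω ∩ B).ncard} ≤ ENNReal.ofReal ((l * c) ^ 2) := by
  have h1 : P {ω | 2 ≤ (𝒱 ω ∩ B).ncard} =
      poissonMeasure (l * (volume B).toNNReal) {k | 2 ≤ k} := by
    rw [← h𝒱.law_count B hB hb,
      Measure.map_apply (h𝒱.measurable_count B hB hb) MeasurableSet.of_discrete]
    rfl
  rw [h1]
  refine (poissonMeasure_two_le _).trans (ENNReal.ofReal_le_ofReal ?_)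
  have h2 : (volume B).toReal ≤ c := ENNReal.toReal_le_of_le_ofReal hc hv
  rw [NNReal.coe_mul, ENNReal.coe_toNNReal_eq_toReal]
  gcongr

/-- A function whose level strips are thin is almost surely injective on the points. -/
theorem ae_injOn (h𝒱 : IsPoissonProcess P l 𝒱) {N : ℝ} (hN : 0 < N) {f : ℝ × ℝ → ℝ}
    (hf : Measurable f) (hfN : ∀ p ∈ square N, f p ∈ Set.Ico (-(2 * N)) (3 * N))
    (hv : ∀ a h : ℝ, volume (strip N f a h) ≤ ENNReal.ofReal h * ENNReal.ofReal N) :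
    ∀ᵐ ω ∂P, Set.InjOn f (𝒱 ω ∩ square N) := by
  -- The range `[-2N, 3N)` of `f` is cut into `n` strips of width `5N / n`. Two points at the same
  -- level fall into the same strip, which has probability of order `1 / n ^ 2`; the union over the
  -- `n` strips has order `1 / n`.
  have hbound : ∀ n : ℕ, 0 < n →
      P {ω | ¬ Set.InjOn f (𝒱 ω ∩ square N)} ≤ ENNReal.ofReal ((l * (5 * N * N)) ^ 2 / n) := by
    intro n hn
    have hn' : (0 : ℝ) < n := Nat.cast_pos.2 hn
    set h : ℝ := 5 * N / n with hh
    have hpos : 0 < h := by positivity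
    have hsub : {ω | ¬ Set.InjOn f (𝒱 ω ∩ square N)} ≤ᵐ[P]
        ⋃ k ∈ Finset.range n, {ω | 2 ≤ (𝒱 ω ∩ strip N f (-(2 * N) + k * h) h).ncard} := by
      filter_upwards [h𝒱.locallyFinite] with ω hfin hω
      have hω : ¬ Set.InjOn f (𝒱 ω ∩ square N) := hω
      simp only [Set.InjOn, not_forall] at hω
      obtain ⟨u, hu, v, hv', heq, hne⟩ := hω
      obtain ⟨h1, h2⟩ := hfN u hu.2
      have h3 : 0 ≤ (f u + 2 * N) / h := div_nonneg (by linarith) hpos.le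
      have h4 := Nat.floor_le h3
      have h5 := Nat.lt_floor_add_one ((f u + 2 * N) / h)
      rw [le_div_iff₀ hpos] at h4
      rw [div_lt_iff₀ hpos] at h5
      have hk : ⌊(f u + 2 * N) / h⌋₊ < n := by
        rw [Nat.floor_lt h3, div_lt_iff₀ hpos, hh]
        field_simp
        linarith
      have hmem : f u ∈ Set.Ico (-(2 * N) + (⌊(f u + 2 * N) / h⌋₊ : ℝ) * h)
          (-(2 * N) + (⌊(f u + 2 * N) / h⌋₊ : ℝ) * h + h) := ⟨by linarith, by linarith⟩
      refine Set.mem_biUnion (Finset.mem_coe.2 (Finset.mem_range.2 hk)) ?_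
      refine (Set.one_lt_ncard (hfin _ ((isBounded_square N).subset fun p hp => hp.1))).2
        ⟨u, ⟨hu.1, hu.2, hmem⟩, v, ⟨hv'.1, hv'.2, ?_⟩, hne⟩
      rw [Set.mem_preimage, ← heq]
      exact hmem
    calc P {ω | ¬ Set.InjOn f (𝒱 ω ∩ square N)}
        ≤ P (⋃ k ∈ Finset.range n,
            {ω | 2 ≤ (𝒱 ω ∩ strip N f (-(2 * N) + k * h) h).ncard}) := measure_mono_ae hsub
      _ ≤ ∑ k ∈ Finset.range n, P {ω | 2 ≤ (𝒱 ω ∩ strip N f (-(2 * N) + k * h) h).ncard} :=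
          measure_biUnion_finset_le _ _
      _ ≤ ∑ _k ∈ Finset.range n, ENNReal.ofReal ((l * (h * N)) ^ 2) := by
          refine Finset.sum_le_sum fun k _ => h𝒱.prob_two_le (measurableSet_strip N hf _ _)
            ((isBounded_square N).subset fun p hp => hp.1) (by positivity) ?_
          rw [ENNReal.ofReal_mul hpos.le]
          exact hv _ _
      _ = ENNReal.ofReal ((l * (5 * N * N)) ^ 2 / n) := by
          rw [Finset.sum_const, Finset.card_range, nsmul_eq_mul, ← ENNReal.ofReal_natCast,
            ← ENNReal.ofReal_mul hn'.le, hh]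
          congr 1
          field_simp
  have hlim : Filter.Tendsto (fun n : ℕ => ENNReal.ofReal ((l * (5 * N * N)) ^ 2 / n))
      Filter.atTop (nhds 0) := by
    rw [← ENNReal.ofReal_zero]
    exact ENNReal.tendsto_ofReal (tendsto_const_div_atTop_nhds_zero_nat _)
  rw [ae_iff]
  exact le_antisymm (ge_of_tendsto hlim
    ((Filter.eventually_gt_atTop 0).mono fun n hn => hbound n hn)) bot_le

theorem ae_isGeneric (h𝒱 : IsPoissonProcess P l 𝒱) {N : ℝ} (hN : 0 < N) :
    ∀ᵐ ω ∂P, IsGeneric N (𝒱 ω ∩ square N) := by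
  -- The frontier of a convex set has measure zero, so no point lies on the sides of the square.
  have hfr := h𝒱.ae_disjoint_of_volume_eq_zero (B := frontier (square N))
    isClosed_frontier.measurableSet
    ((isBounded_square N).subset (isClosed_Icc.prod isClosed_Icc).frontier_subset)
    (((convex_Icc 0 N).prod (convex_Icc 0 N)).addHaar_frontier volume)
  have hx := h𝒱.ae_injOn hN (f := fun p => p.1) (by fun_prop)
    (fun p hp => ⟨by linarith [hp.1.1], by linarith [hp.1.2]⟩) (volume_strip_fst N)
  have hy := h𝒱.ae_injOn hN (f := fun p => p.2 + 0 * p.1) (by fun_prop)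
    (fun p hp => ⟨by linarith [hp.2.1], by linarith [hp.2.2]⟩) (volume_strip_snd_add N 0)
  have ha := h𝒱.ae_injOn hN (f := fun p => p.2 + 1 * p.1) (by fun_prop)
    (fun p hp => ⟨by linarith [hp.1.1, hp.2.1], by linarith [hp.1.2, hp.2.2]⟩)
    (volume_strip_snd_add N 1)
  have hs := h𝒱.ae_injOn hN (f := fun p => p.2 + (-1) * p.1) (by fun_prop)
    (fun p hp => ⟨by linarith [hp.1.2, hp.2.1], by linarith [hp.1.1, hp.2.2]⟩)
    (volume_strip_snd_add N (-1))
  filter_upwards [h𝒱.locallyFinite, hfr, hx, hy, ha, hs] with ω hfin hfr hx hy ha hs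
  have hint : ∀ u ∈ 𝒱 ω ∩ square N, u ∈ Set.Ioo 0 N ×ˢ Set.Ioo 0 N := by
    intro u hu
    have h1 : u ∈ square N \ frontier (square N) :=
      ⟨hu.2, fun h => (hfr ▸ (⟨hu.1, h⟩ : u ∈ 𝒱 ω ∩ frontier (square N)) : u ∈ (∅ : Set _))⟩
    rwa [self_sdiff_frontier, square, interior_prod_eq, interior_Icc] at h1
  refine ⟨hfin _ (isBounded_square N), fun u hu => (hint u hu).1, fun u hu => (hint u hu).2, hx,
    ?_, ?_, ?_⟩
  · simpa using hy
  · simpa using ha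
  · simpa [sub_eq_add_neg] using hs

end IsPoissonProcess

end RectGilbert

theorem proposition3 {Ω : Type*} [MeasurableSpace Ω] (P : Measure Ω) [IsProbabilityMeasure P]
    (l : ℝ≥0) (hl : 0 < l)
    (𝒱 : Ω → Set (ℝ × ℝ)) (h𝒱 : RectGilbert.IsPoissonProcess P l 𝒱)
    (d : Ω → ℝ × ℝ → RectGilbert.Direction) (hd : RectGilbert.IsIndependentMarking P 𝒱 d)
    (N : ℝ) (hN : 2 < N) :
    ∀ᵐ ω ∂P,
      {F : Set (ℝ × ℝ) | RectGilbert.IsFace (RectGilbert.tessellation (𝒱 ω) (d ω) N) F ∧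
          RectGilbert.IsRectangle F}.ncard
        = (𝒱 ω ∩ RectGilbert.square N).ncard + 1 ∧
      ∀ F : Set (ℝ × ℝ), RectGilbert.IsFace (RectGilbert.tessellation (𝒱 ω) (d ω) N) F →
        Bornology.IsBounded F → RectGilbert.IsRectangle F := by
  have hN0 : 0 < N := by linarith
  filter_upwards [h𝒱.ae_isGeneric hN0] with ω hω
  exact hω.ncard_faces hN0 (d ω)
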